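/- Let $k:\mathbb{R}^d\times\mathbb{R}^d\to\mathbb{R}$ be a translation-invariant kernel with spectral measure $\Lambda$, i.e. $\Lambda$ is a Borel probability measure on $\mathbb{R}^d$ with $$k(\mathbf{x},\mathbf{y})=\int_{\mathbb{R}^d}e^{\sqrt{-1}\,\boldsymbol\omega^T(\mathbf{x}-\mathbf{y})}\,d\Lambda(\boldsymbol\omega)\qquad(\mathbf{x},\mathbf{y}\in\mathbb{R}^d).$$ For multi-indices $\mathbf{p},\mathbf{q}\in\mathbb{N}^d$ write $\boldsymbol\omega^{\mathbf{p}}=\prod_i\omega_i^{p_i}$, $|\mathbf{p}|=\sum_i p_i$, $h_n(v)=\cos(n\pi/2+v)$, and $$T_{\mathbf{p},\mathbf{q}}=\sup_{\boldsymbol\omega\in\mathrm{supp}(\Lambda)}|\boldsymbol\omega^{\mathbf{p}+\mathbf{q}}|,\qquad C_{\mathbf{p},\mathbf{q}}=\int|\boldsymbol\omega^{\mathbf{p}+\mathbf{q}}|\,\|\boldsymbol\omega\|_2^2\,d\Lambda(\boldsymbol\omega).$$ Fix $\mathbf{p},\mathbf{q}\in\mathbb{N}^d$ and assume that $\int|\boldsymbol\omega^{\mathbf{r}}|\,d\Lambda(\boldsymbol\omega)<\infty$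 for every multi-index $\mathbf{r}\le\mathbf{p}+\mathbf{q}$ (componentwise), that $T_{\mathbf{p},\mathbf{q}}<\infty$ and $C_{2\mathbf{p},2\mathbf{q}}<\infty$ (all of this holds if $\Lambda$ has bounded support), and that $T_{2\mathbf{p},2\mathbf{q}}>0$. Then the mixed partial derivative $\partial^{\mathbf{p},\mathbf{q}}k$ (of order $\mathbf{p}$ in $\mathbf{x}$ and $\mathbf{q}$ in $\mathbf{y}$) exists on $\mathbb{R}^d\times\mathbb{R}^d$ and does not depend on the order in which the partial derivatives are taken. Let $m\ge1$ and, for $\boldsymbol\omega_1,\dots,\boldsymbol\omega_m\in\mathbb{R}^d$, let $$s^{\mathbf{p},\mathbf{q}}(\mathbf{x},\mathbf{y})=\frac1m\sum_{j=1}^m\boldsymbol\omega_j^{\mathbf{p}}(-\boldsymbol\omega_j)^{\mathbf{q}}\,h_{|\mathbf{p}+\mathbf{q}|}\big(\boldsymbol\omega_j^T(\mathbf{x}-\mathbf{y})\big)$$ be the random Fourier feature estimate. Then for every compact $S\subset\mathbb{R}^d$ with at least two points, of Euclidean diameter $|S|$, and every $\tau>0$, $$\Lambda^m\left(\sup_{\mathbf{x},\mathbf{y}\in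 S}\big|\partial^{\mathbf{p},\mathbf{q}}k(\mathbf{x},\mathbf{y})-s^{\mathbf{p},\mathbf{q}}(\mathbf{x},\mathbf{y})\big|\ \ge\ \frac{H}{\sqrt m}+T_{\mathbf{p},\mathbf{q}}\sqrt{\frac{2\tau}{m}}\right)\le e^{-\tau},$$ where $\Lambda^m$ is the law of i.i.d. $\boldsymbol\omega_1,\dots,\boldsymbol\omega_m\sim\Lambda$ and $$H=32\sqrt{2d\,T_{2\mathbf{p},2\mathbf{q}}}\left[\sqrt{U}+\frac1{2\sqrt{U}}+\sqrt{\log\big(\sqrt{C_{2\mathbf{p},2\mathbf{q}}}+1\big)}\right],\qquad U=\log\left(\frac{2|S|}{\sqrt{T_{2\mathbf{p},2\mathbf{q}}}}+1\right).$$ That is, with probability at least $1-e^{-\tau}$ the estimate $s^{\mathbf{p},\mathbf{q}}$ approximates $\partial^{\mathbf{p},\mathbf{q}}k$ uniformly on $S\times S$ with error less than $H/\sqrt m+T_{\mathbf{p},\mathbf{q}}\sqrt{2\tau/m}$. -/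

import Mathlib

open MeasureTheory Set

noncomputable section

namespace RandomFourier

/-- Frequency and input space `ℝ^d` with its Euclidean norm. -/
abbrev Space (d : ℕ) : Type := EuclideanSpace ℝ (Fin d)

/-- The monomial `ω^p = ∏ i, (ω i)^(p i)`. -/
def monomial {d : ℕ} (p : Fin d → ℕ) (ω : Space d) : ℝ := ∏ i, ω i ^ p i

/-- The order `|p| = ∑ i, p i` of a multi-index. -/
def order {d : ℕ} (p : Fin d → ℕ) : ℕ := ∑ i, p i

/-- The function `h_n(v) = cos (n π / 2 + v)`, the `n`-th derivative of the cosine. -/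
def h (n : ℕ) (v : ℝ) : ℝ := Real.cos (n * Real.pi / 2 + v)

/-- `Λ` is the spectral measure of the (real) kernel `k`, so that `k` is translation invariant:
`k(x,y) = ∫ exp(i ⟨ω, x - y⟩) dΛ(ω)`. -/
def IsSpectralMeasure {d : ℕ} (k : Space d → Space d → ℝ) (Λ : Measure (Space d)) : Prop :=
  ∀ x y, (k x y : ℂ) = charFun Λ (x - y)

/-- `HasMixedPartial p q k D`: the mixed partial derivative of `k`, of order `p` in the first
argument and of order `q` in the second one, exists on `ℝ^d × ℝ^d` and equals `D`, the single
partial derivatives being taken one after the other (in some order). -/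
inductive HasMixedPartial {d : ℕ} (k : Space d → Space d → ℝ) :
    (Fin d → ℕ) → (Fin d → ℕ) → (Space d → Space d → ℝ) → Prop
  | zero : HasMixedPartial k 0 0 k
  | left {p q : Fin d → ℕ} {D D' : Space d → Space d → ℝ} (i : Fin d)
      (hD : HasMixedPartial k p q D)
      (hD' : ∀ x y, HasLineDerivAt ℝ (fun u => D u y) (D' x y) x (EuclideanSpace.single i 1)) :
      HasMixedPartial k (p + Pi.single i 1) q D'
  | right {p q : Fin d → ℕ} {D D' : Space d → Space d → ℝ} (i : Fin d)
      (hD : HasMixedPartial k p q D)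
      (hD' : ∀ x y, HasLineDerivAt ℝ (fun v => D x v) (D' x y) y (EuclideanSpace.single i 1)) :
      HasMixedPartial k p (q + Pi.single i 1) D'

/-- The random Fourier feature estimate `s^{p,q}` built from the frequencies `ω_1, …, ω_m`. -/
def rffEstimate {d m : ℕ} (p q : Fin d → ℕ) (ω : Fin m → Space d) (x y : Space d) : ℝ :=
  (1 / (m : ℝ)) * ∑ j, monomial p (ω j) * monomial q (-(ω j)) *
    h (order (p + q)) (inner ℝ (ω j) (x - y))

/-- `T_{p,q} = sup { |ω^{p+q}| : ω ∈ supp Λ }`. -/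
def T {d : ℕ} (Λ : Measure (Space d)) (p q : Fin d → ℕ) : ℝ :=
  sSup ((fun ω => |monomial (p + q) ω|) '' Λ.support)

/-- `C_{p,q} = ∫ |ω^{p+q}| ‖ω‖² dΛ(ω)`. -/
def C {d : ℕ} (Λ : Measure (Space d)) (p q : Fin d → ℕ) : ℝ :=
  ∫ ω, |monomial (p + q) ω| * ‖ω‖ ^ 2 ∂Λ

/-- `U = log (2 |S| / √T_{2p,2q} + 1)`, where `|S|` is the diameter of `S`. -/
def U {d : ℕ} (Λ : Measure (Space d)) (p q : Fin d → ℕ) (S : Set (Space d)) : ℝ :=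
  Real.log (2 * Metric.diam S / √(T Λ (2 • p) (2 • q)) + 1)

/-- `32 √(2 d T_{2p,2q}) (√U + 1 / (2 √U) + √(log (√C_{2p,2q} + 1)))`. -/
def H {d : ℕ} (Λ : Measure (Space d)) (p q : Fin d → ℕ) (S : Set (Space d)) : ℝ :=
  32 * √(2 * d * T Λ (2 • p) (2 • q)) *
    (√(U Λ p q S) + 1 / (2 * √(U Λ p q S)) + √(Real.log (√(C Λ (2 • p) (2 • q)) + 1)))

/-- The uniform norm `sup { |f(x,y)| : x, y ∈ S }`, with values in `[0, ∞]`. -/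
def supNormOn {d : ℕ} (S : Set (Space d)) (f : Space d → Space d → ℝ) : ENNReal :=
  ⨆ x ∈ S, ⨆ y ∈ S, ENNReal.ofReal |f x y|

end RandomFourier

end

/-!
The derivative `∂^{p,q} k` is obtained by differentiating `k(x,y) = ∫ cos ⟪ω, x - y⟫ dΛ(ω)` under
the integral sign, one variable at a time. Each step multiplies the integrand by `±ω i` and turns
`h n` into `h (n + 1)`, and the moments of order `r ≤ p + q` dominate. The result, `kernelDeriv`,
does not depend on the order of the steps (`hasMixedPartial_kernelDeriv`,
`HasMixedPartial.eq_kernelDeriv`). Hence `∂^{p,q} k - s^{p,q}` is the deviation of an empirical mean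
of the functions `ω ↦ a(ω) h(⟪ω, z⟫)`, `z = x - y`, from its expectation, where
`a(ω) = ω^p (-ω)^q`.

The supremum of this deviation changes by at most `2 T_{p,q} / m` when one frequency is replaced,
so it exceeds its expectation by `T_{p,q} √(2τ/m)` with probability at most `exp (-τ)`. This is
McDiarmid's inequality, `hasSubgaussianMGF_of_bounded_differences`, proved by integrating out the
variables one at a time with Hoeffding's lemma.

The expectation is bounded by `H / √m` in three steps.
* Symmetrization (`integral_iSup_abs_sum_sub_integral_le`) replaces the deviation by Rademacher
  sums.
* For fixed frequencies these are sub-Gaussian, with increments controlled by `A ‖z - z'‖`, where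
  `A² = m⁻¹ ∑ a(ω j)² ‖ω j‖²`. The differences `z` lie in a ball of radius `|S|` of `ℝ^d` and so
  have a `δ`-net of at most `(1 + 2|S|/δ)^d` points (`exists_finset_net`). Therefore chaining
  (`expect_sup_rademacherSum_le`) bounds the normalized sums by a constant times
  `√(d T_{2p,2q} / m) (√U + √(log (1 + A)) + 3)`. Using `1 + A` in place of
  `A` as Lipschitz constant separates the two logarithms and avoids the degenerate case `A = 0`.
* Since `A²` has expectation `C_{2p,2q}`, Jensen's inequality for the concave function
  `t ↦ √(log (1 + √t))` replaces `A` by `√C_{2p,2q}`.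

The constants obtained are smaller than those in `H` (`chaining_bound_le_H`). Suprema over the
compact set `S × S` are suprema over a countable dense set of differences, so they are measurable.
-/

open scoped BigOperators

namespace RandomFourier

/-! ### Rademacher sums and the maximal inequality -/

/-- The Rademacher sum `∑ j, ε j * v j` of the vector `v`; the sign `ε j = ±1` is encoded by a
Boolean, `true` standing for `1`. -/
noncomputable def rademacherSum {ι : Type*} [Fintype ι] (v : ι → ℝ) (ε : ι → Bool) : ℝ :=
  ∑ j, (if ε j then v j else -v j)

section Rademacher

variable {ι : Type*} [Fintype ι]

lemma rademacherSum_smul (c : ℝ) (v : ι → ℝ) (ε : ι → Bool) :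
    rademacherSum (fun j => c * v j) ε = c * rademacherSum v ε := by
  simp only [rademacherSum, Finset.mul_sum]
  refine Finset.sum_congr rfl fun j _ => ?_
  split_ifs <;> ring

lemma rademacherSum_sub (v w : ι → ℝ) (ε : ι → Bool) :
    rademacherSum (fun j => v j - w j) ε = rademacherSum v ε - rademacherSum w ε := by
  simp only [rademacherSum, ← Finset.sum_sub_distrib]
  refine Finset.sum_congr rfl fun j _ => ?_
  split_ifs <;> ring

lemma abs_rademacherSum_le (v : ι → ℝ) (ε : ι → Bool) :
    |rademacherSum v ε| ≤ ∑ j, |v j| := by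
  refine (Finset.abs_sum_le_sum_abs _ _).trans (Finset.sum_le_sum fun j _ => ?_)
  split_ifs <;> simp

lemma abs_rademacherSum_le_sqrt (v : ι → ℝ) (ε : ι → Bool) {r : ℝ} (hr : 0 ≤ r)
    (hv : ∑ j, v j ^ 2 ≤ r ^ 2) :
    |rademacherSum v ε| ≤ √(Fintype.card ι) * r := by
  refine (abs_rademacherSum_le v ε).trans ?_
  have h := sq_sum_le_card_mul_sum_sq (s := Finset.univ) (f := fun j => |v j|)
  simp only [sq_abs] at h
  refine le_of_sq_le_sq ?_ (by positivity)
  rw [mul_pow, Real.sq_sqrt (by positivity)]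
  refine h.trans ?_
  rw [Finset.card_univ]
  gcongr

variable [DecidableEq ι]

/-- The Rademacher sum of `v` is sub-Gaussian with variance proxy `∑ j, v j ^ 2`. -/
lemma expect_exp_rademacherSum_le (v : ι → ℝ) :
    𝔼 ε : ι → Bool, Real.exp (rademacherSum v ε) ≤ Real.exp ((∑ j, v j ^ 2) / 2) := by
  have h1 : ∑ ε : ι → Bool, Real.exp (rademacherSum v ε) = ∏ j, (2 * Real.cosh (v j)) := by
    simp only [rademacherSum, Real.exp_sum]
    rw [← Fintype.prod_sum (fun j (b : Bool) => Real.exp (if b then v j else -v j))]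
    refine Finset.prod_congr rfl fun j _ => ?_
    rw [Fintype.sum_bool, Real.cosh_eq]
    simp only [if_true, Bool.false_eq_true, if_false]
    ring
  rw [Fintype.expect_eq_sum_div_card, h1, Finset.prod_mul_distrib]
  simp only [Finset.prod_const, Finset.card_univ, Fintype.card_pi, Fintype.card_bool]
  push_cast
  rw [mul_div_cancel_left₀ _ (by positivity), Finset.sum_div, Real.exp_sum]
  exact Finset.prod_le_prod (fun j _ => (Real.cosh_pos _).le)
    fun j _ => Real.cosh_le_exp_half_sq _

/-- Massart's maximal inequality: a pointwise maximum `M` of `|∑ j, ε j * v k j|` over a finite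
set of indices `k` has expectation at most `σ * √(2 ℓ)`, if `2 * #s ≤ exp ℓ` and all vectors have
Euclidean norm at most `σ`. -/
lemma expect_max_rademacherSum_le {κ : Type*} (s : Finset κ) (v : κ → ι → ℝ) {σ ℓ : ℝ}
    (hσ : 0 < σ) (hℓ : 0 < ℓ) (hs : 2 * (s.card : ℝ) ≤ Real.exp ℓ)
    (hv : ∀ k ∈ s, ∑ j, v k j ^ 2 ≤ σ ^ 2) (M : (ι → Bool) → ℝ)
    (hM : ∀ ε, ∃ k ∈ s, M ε ≤ |rademacherSum (v k) ε|) :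
    𝔼 ε, M ε ≤ σ * √(2 * ℓ) := by
  -- The optimal parameter in the exponential Markov inequality.
  set t : ℝ := √(2 * ℓ) / σ with ht
  have hq : 0 < √(2 * ℓ) := Real.sqrt_pos.2 (by positivity)
  have htpos : 0 < t := by positivity
  have hts : t ^ 2 * σ ^ 2 = 2 * ℓ := by
    rw [ht, div_pow, Real.sq_sqrt (by positivity)]; field_simp
  have hexp : ∀ k ∈ s, ∀ r : ℝ, r ^ 2 = t ^ 2 →
      𝔼 ε : ι → Bool, Real.exp (r * rademacherSum (v k) ε) ≤ Real.exp ℓ := by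
    intro k hk r hr
    simp only [← rademacherSum_smul]
    refine (expect_exp_rademacherSum_le _).trans (Real.exp_le_exp.2 ?_)
    simp only [mul_pow, hr, ← Finset.mul_sum]
    nlinarith [hv k hk, sq_nonneg t]
  have hpt : ∀ ε, t * M ε ≤ 2 * ℓ - 1 + Real.exp (-(2 * ℓ)) *
      ∑ k ∈ s, (Real.exp (t * rademacherSum (v k) ε) +
        Real.exp ((-t) * rademacherSum (v k) ε)) := by
    intro ε
    obtain ⟨k, hk, hkM⟩ := hM ε
    have h1 : Real.exp (t * M ε) ≤ ∑ k ∈ s, (Real.exp (t * rademacherSum (v k) ε) +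
        Real.exp ((-t) * rademacherSum (v k) ε)) := by
      refine le_trans ?_ (Finset.single_le_sum (f := fun k =>
        Real.exp (t * rademacherSum (v k) ε) + Real.exp ((-t) * rademacherSum (v k) ε))
        (fun k _ => by positivity) hk)
      refine (Real.exp_le_exp.2 (mul_le_mul_of_nonneg_left hkM htpos.le)).trans ?_
      rcases abs_cases (rademacherSum (v k) ε) with ⟨h, -⟩ | ⟨h, -⟩ <;> rw [h]
      · exact le_add_of_nonneg_right (Real.exp_pos _).le
      · rw [mul_neg, ← neg_mul]
        exact le_add_of_nonneg_left (Real.exp_pos _).le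
    have h2 := Real.add_one_le_exp (t * M ε - 2 * ℓ)
    rw [sub_eq_add_neg, Real.exp_add, mul_comm (Real.exp _)] at h2
    have h3 := mul_le_mul_of_nonneg_left h1 (Real.exp_pos (-(2 * ℓ))).le
    linarith
  have hE := Finset.expect_le_expect (s := Finset.univ) fun ε _ => hpt ε
  rw [← Finset.mul_expect, Finset.expect_add_distrib, Fintype.expect_const,
    ← Finset.mul_expect, Finset.expect_sum_comm] at hE
  have hsum : ∑ k ∈ s, 𝔼 ε : ι → Bool, (Real.exp (t * rademacherSum (v k) ε) +
      Real.exp ((-t) * rademacherSum (v k) ε)) ≤ Real.exp (2 * ℓ) := by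
    calc _ ≤ ∑ k ∈ s, 2 * Real.exp ℓ := by
          refine Finset.sum_le_sum fun k hk => ?_
          rw [Finset.expect_add_distrib]
          linarith [hexp k hk t rfl, hexp k hk (-t) (by ring)]
      _ = 2 * s.card * Real.exp ℓ := by rw [Finset.sum_const, nsmul_eq_mul]; ring
      _ ≤ Real.exp ℓ * Real.exp ℓ := by gcongr
      _ = Real.exp (2 * ℓ) := by rw [← Real.exp_add]; ring_nf
  have h4 := mul_le_mul_of_nonneg_left hsum (Real.exp_pos (-(2 * ℓ))).le
  rw [← Real.exp_add, neg_add_cancel, Real.exp_zero] at h4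
  have h5 : t * 𝔼 ε, M ε ≤ 2 * ℓ := by linarith
  have h6 : t * (σ * √(2 * ℓ)) = 2 * ℓ := by
    rw [ht]; field_simp; exact Real.sq_sqrt (by positivity)
  exact le_of_mul_le_mul_left (h5.trans h6.ge) htpos

end Rademacher

/-! ### Nets in Euclidean balls -/

section Nets

open Metric Module

variable {E : Type*} [NormedAddCommGroup E] [NormedSpace ℝ E] [FiniteDimensional ℝ E]

/-- Volume bound for packings: the balls of radius `δ / 2` around the points of a `δ`-separated
subset of a ball of radius `R` are disjoint and lie in a ball of radius `R + δ / 2`. -/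
lemma card_le_of_separated_of_norm_le {R δ : ℝ} (hR : 0 ≤ R) (hδ : 0 < δ) (s : Finset E)
    (hs : ∀ c ∈ s, ‖c‖ ≤ R) (h : ∀ c ∈ s, ∀ d ∈ s, c ≠ d → δ ≤ ‖c - d‖) :
    (s.card : ℝ) ≤ (1 + 2 * R / δ) ^ finrank ℝ E := by
  borelize E
  let μ : Measure E := Measure.addHaar
  have hρ : 0 < R + δ / 2 := by positivity
  have hδ2 : 0 < δ / 2 := by positivity
  have hdisj : (s : Set E).PairwiseDisjoint fun c => ball c (δ / 2) := by
    intro c hc d hd hcd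
    refine ball_disjoint_ball ?_
    rw [dist_eq_norm]
    linarith [h c hc d hd hcd]
  have hsub : (⋃ c ∈ s, ball c (δ / 2)) ⊆ ball (0 : E) (R + δ / 2) := by
    refine iUnion₂_subset fun x hx => ball_subset_ball' ?_
    rw [dist_zero_right]
    linarith [hs x hx]
  have hvol : (s.card : ENNReal) * ENNReal.ofReal ((δ / 2) ^ finrank ℝ E) * μ (ball 0 1) ≤
      ENNReal.ofReal ((R + δ / 2) ^ finrank ℝ E) * μ (ball 0 1) := by
    have := measure_mono (μ := μ) hsub
    rw [measure_biUnion_finset hdisj fun c _ => measurableSet_ball] at this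
    simpa only [μ.addHaar_ball_of_pos _ hδ2, μ.addHaar_ball_of_pos _ hρ, Finset.sum_const,
      nsmul_eq_mul, mul_assoc] using this
  have hle := (ENNReal.mul_le_mul_iff_left (measure_ball_pos μ _ zero_lt_one).ne'
    measure_ball_lt_top.ne).1 hvol
  have hreal := ENNReal.toReal_le_of_le_ofReal (by positivity) hle
  rw [ENNReal.toReal_mul, ENNReal.toReal_natCast, ENNReal.toReal_ofReal (by positivity)] at hreal
  rw [show 1 + 2 * R / δ = (R + δ / 2) / (δ / 2) by field_simp; ring, div_pow,
    le_div_iff₀ (by positivity)]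
  exact hreal

/-- A subset of a ball of radius `R` has a `δ`-net of cardinality at most `(1 + 2 R / δ) ^ dim`,
consisting of points of the set. -/
lemma exists_finset_net {A : Set E} {R δ : ℝ} (hR : 0 ≤ R) (hδ : 0 < δ)
    (hA : ∀ x ∈ A, ‖x‖ ≤ R) :
    ∃ s : Finset E, (∀ x ∈ s, x ∈ A) ∧ (∀ x ∈ A, ∃ y ∈ s, ‖x - y‖ ≤ δ) ∧
      (s.card : ℝ) ≤ (1 + 2 * R / δ) ^ finrank ℝ E := by
  classical
  let P : ℕ → Prop := fun n => ∃ s : Finset E, s.card = n ∧ (∀ x ∈ s, x ∈ A) ∧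
    ∀ c ∈ s, ∀ d ∈ s, c ≠ d → δ ≤ ‖c - d‖
  have hP0 : P 0 := ⟨∅, by simp⟩
  have hPb : ∀ n, P n → n ≤ ⌊(1 + 2 * R / δ) ^ finrank ℝ E⌋₊ := by
    rintro n ⟨s, rfl, hsA, hsep⟩
    exact Nat.le_floor (card_le_of_separated_of_norm_le hR hδ s (fun c hc => hA c (hsA c hc)) hsep)
  obtain ⟨s, hcard, hsA, hsep⟩ := Nat.findGreatest_spec (P := P)
    (n := ⌊(1 + 2 * R / δ) ^ finrank ℝ E⌋₊) (Nat.zero_le _) hP0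
  refine ⟨s, hsA, fun x hx => ?_,
    card_le_of_separated_of_norm_le hR hδ s (fun c hc => hA c (hsA c hc)) hsep⟩
  -- A separated set of maximal cardinality is a net, as no point can be added to it.
  by_contra! hcon
  have hxs : x ∉ s := fun hxs => by
    have := hcon x hxs
    rw [sub_self, norm_zero] at this
    linarith
  have hP : P (s.card + 1) := by
    refine ⟨insert x s, Finset.card_insert_of_notMem hxs, ?_, ?_⟩
    · intro y hy
      rcases Finset.mem_insert.1 hy with rfl | hy
      exacts [hx, hsA y hy]
    · intro c hc d hd hcd
      rcases Finset.mem_insert.1 hc with rfl | hc <;> rcases Finset.mem_insert.1 hd with rfl | hd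
      · exact absurd rfl hcd
      · exact (hcon d hd).le
      · rw [norm_sub_rev]; exact (hcon c ‹_›).le
      · exact hsep c hc d hd hcd
  have := Nat.le_findGreatest (hPb _ hP) hP
  omega

end Nets

/-! ### Chaining -/

section Chaining

variable {ι : Type*} [Fintype ι] [DecidableEq ι]
variable {E : Type*} [NormedAddCommGroup E] [NormedSpace ℝ E] [FiniteDimensional ℝ E]

lemma sum_range_div_two_pow (w : ℝ) (hw : 0 ≤ w) (K : ℕ) :
    ∑ k ∈ Finset.range K, (w + (k + 2)) / 2 ^ k ≤ 2 * w + 6 := by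
  have h : ∑ k ∈ Finset.range K, (w + ((k : ℝ) + 2)) / 2 ^ k
      = 2 * w + 6 - (2 * w + 2 * K + 6) / 2 ^ K := by
    induction K with
    | zero => simp
    | succ K ih => rw [Finset.sum_range_succ, ih, pow_succ]; push_cast; field_simp; ring
  rw [h]
  have : 0 ≤ (2 * w + 2 * (K : ℝ) + 6) / 2 ^ K := by positivity
  linarith

/-- Dudley's chaining bound. If the vectors `v z`, `z ∈ Z`, have Euclidean norm at most `R` and
`v` is `L`-Lipschitz on `Z`, a subset of a ball of radius `D`, the suprema of the Rademacher
sums are bounded in expectation by the sum of the maximal inequalities along nets of mesh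
`2⁻⁽ᵏ⁺¹⁾ R / L`. -/
theorem expect_sup_rademacherSum_le {Z : Set E} (v : E → ι → ℝ) {D R L : ℝ}
    (hE : 0 < Module.finrank ℝ E) (hD : 0 ≤ D) (hR : 0 < R) (hL : 0 < L)
    (hZD : ∀ z ∈ Z, ‖z‖ ≤ D) (hv : ∀ z ∈ Z, ∑ j, v z j ^ 2 ≤ R ^ 2)
    (hlip : ∀ z ∈ Z, ∀ z' ∈ Z, ∑ j, (v z j - v z' j) ^ 2 ≤ (L * ‖z - z'‖) ^ 2)
    (F : (ι → Bool) → ℝ)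
    (hF : ∀ ε, ∀ b, (∀ z ∈ Z, |rademacherSum (v z) ε| ≤ b) → F ε ≤ b) :
    𝔼 ε, F ε ≤ R * √(2 * Module.finrank ℝ E) *
      (2 * √(Real.log (1 + 2 * D * L / R)) + 6) := by
  set d := Module.finrank ℝ E
  set W := Real.log (1 + 2 * D * L / R) with hW
  have hq : 0 ≤ 2 * D * L / R := by positivity
  have hW0 : 0 ≤ W := Real.log_nonneg (by linarith)
  rcases Z.eq_empty_or_nonempty with rfl | ⟨z₀, hz₀⟩
  · refine (Finset.expect_le_expect fun ε _ => hF ε 0 (by simp)).trans ?_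
    rw [Fintype.expect_const]
    positivity
  have hnet : ∀ k : ℕ, ∃ s : Finset E, (∀ x ∈ s, x ∈ Z) ∧
      (∀ x ∈ Z, ∃ y ∈ s, ‖x - y‖ ≤ R / 2 ^ (k + 1) / L) ∧
      (s.card : ℝ) ≤ (1 + 2 * D / (R / 2 ^ (k + 1) / L)) ^ d := fun k =>
    exists_finset_net hD (by positivity) hZD
  choose N hNZ hNnet hNcard using hnet
  have hNne : ∀ k, (N k).Nonempty := fun k => by
    obtain ⟨y, hy, -⟩ := hNnet k z₀ hz₀
    exact ⟨y, hy⟩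
  -- The logarithm of twice the cardinality of the `k`-th net.
  set ℓ : ℕ → ℝ := fun k => d * ((k + 2) * Real.log 2 + W) with hℓ
  have hlog2 : 0 < Real.log 2 := Real.log_pos (by norm_num)
  have hd0 : (0 : ℝ) < d := by exact_mod_cast hE
  have hℓpos : ∀ k, 0 < ℓ k := fun k => by positivity
  have hcard : ∀ k, 2 * ((N k).card : ℝ) ≤ Real.exp (ℓ k) := by
    intro k
    have h1 : Real.exp (ℓ k) = (2 ^ (k + 2) * (1 + 2 * D * L / R)) ^ d := by
      rw [hℓ]
      simp only
      rw [Real.exp_nat_mul, Real.exp_add, hW, Real.exp_log (by positivity)]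
      congr 2
      rw [show ((k : ℝ) + 2) = ((k + 2 : ℕ) : ℝ) by push_cast; ring, Real.exp_nat_mul,
        Real.exp_log (by norm_num)]
    have h2 : 1 + 2 * D / (R / 2 ^ (k + 1) / L) ≤ 2 ^ (k + 1) * (1 + 2 * D * L / R) := by
      have : 2 * D / (R / 2 ^ (k + 1) / L) = 2 ^ (k + 1) * (2 * D * L / R) := by field_simp
      rw [this, mul_add, mul_one]
      have : (1 : ℝ) ≤ 2 ^ (k + 1) := one_le_pow₀ (by norm_num)
      linarith
    calc 2 * ((N k).card : ℝ) ≤ 2 ^ d * (2 ^ (k + 1) * (1 + 2 * D * L / R)) ^ d := by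
          gcongr
          · exact le_self_pow₀ (by norm_num) hE.ne'
          · exact (hNcard k).trans (by gcongr)
      _ = Real.exp (ℓ k) := by rw [h1, ← mul_pow]; congr 1; ring
  have hℓsqrt : ∀ k : ℕ, √(2 * ℓ k) ≤ √(2 * d) * (√W + (k + 2)) := by
    intro k
    rw [show 2 * ℓ k = (2 * d) * ((k + 2) * Real.log 2 + W) by rw [hℓ]; ring,
      Real.sqrt_mul (by positivity)]
    gcongr
    refine Real.sqrt_le_iff.2 ⟨by positivity, ?_⟩
    have h1 : Real.log 2 ≤ 1 := (Real.log_two_lt_d9.trans (by norm_num)).le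
    have h2 : 0 ≤ √W * ((k : ℝ) + 2) := by positivity
    have h3 : (0 : ℝ) ≤ k := by positivity
    nlinarith [Real.sq_sqrt hW0, mul_nonneg h3 (sub_nonneg.2 h1)]
  -- The maximum over the `k`-th net of one link of the chain.
  have hmax : ∀ (k : ℕ) (w : E → ι → ℝ), (∀ z ∈ N k, ∑ j, w z j ^ 2 ≤ (R / 2 ^ k) ^ 2) →
      ∃ M : (ι → Bool) → ℝ, (∀ ε, ∀ z ∈ N k, |rademacherSum (w z) ε| ≤ M ε) ∧
        𝔼 ε, M ε ≤ R * √(2 * d) * ((√W + (k + 2)) / 2 ^ k) := by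
    intro k w hw
    refine ⟨fun ε => (N k).sup' (hNne k) fun z => |rademacherSum (w z) ε|,
      fun ε z hz => Finset.le_sup' (fun z => |rademacherSum (w z) ε|) hz, ?_⟩
    refine (expect_max_rademacherSum_le (N k) w (by positivity) (hℓpos k) (hcard k) hw _
      fun ε => ?_).trans ?_
    · obtain ⟨z, hz, h⟩ := Finset.exists_mem_eq_sup' (hNne k) fun z => |rademacherSum (w z) ε|
      exact ⟨z, hz, h.le⟩
    · calc R / 2 ^ k * √(2 * ℓ k) ≤ R / 2 ^ k * (√(2 * d) * (√W + (k + 2))) := by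
            gcongr; exact hℓsqrt k
        _ = _ := by ring
  have hchain : ∀ K : ℕ, ∃ M : (ι → Bool) → ℝ,
      (∀ ε, ∀ z ∈ N K, |rademacherSum (v z) ε| ≤ M ε) ∧
        𝔼 ε, M ε ≤ R * √(2 * d) *
          ∑ k ∈ Finset.range (K + 1), (√W + ((k : ℝ) + 2)) / 2 ^ k := by
    intro K
    induction K with
    | zero =>
      obtain ⟨M, hM, hME⟩ := hmax 0 v fun z hz => by simpa using hv z (hNZ 0 z hz)
      exact ⟨M, hM, by simpa using hME⟩
    | succ K ih =>
      obtain ⟨M, hM, hME⟩ := ih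
      have hπ : ∀ z : E, ∃ y, z ∈ Z → y ∈ N K ∧ ‖z - y‖ ≤ R / 2 ^ (K + 1) / L := fun z => by
        by_cases hz : z ∈ Z
        · obtain ⟨y, hy, h⟩ := hNnet K z hz
          exact ⟨y, fun _ => ⟨hy, h⟩⟩
        · exact ⟨0, fun h => absurd h hz⟩
      choose π hπ using hπ
      obtain ⟨M', hM', hME'⟩ := hmax (K + 1) (fun z j => v z j - v (π z) j) fun z hz => by
        obtain ⟨h1, h2⟩ := hπ z (hNZ _ z hz)
        refine (hlip z (hNZ _ z hz) _ (hNZ _ _ h1)).trans ?_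
        gcongr
        rwa [le_div_iff₀ hL, mul_comm] at h2
      refine ⟨fun ε => M ε + M' ε, fun ε z hz => ?_, ?_⟩
      · have h1 := hM ε _ (hπ z (hNZ _ z hz)).1
        have h2 := hM' ε z hz
        rw [rademacherSum_sub] at h2
        have h3 := abs_sub_abs_le_abs_sub (rademacherSum (v z) ε) (rademacherSum (v (π z)) ε)
        linarith
      · rw [Finset.expect_add_distrib, Finset.sum_range_succ, mul_add]
        exact add_le_add hME (by exact_mod_cast hME')
  -- The part of the chain beyond the `K`-th net is controlled pointwise and vanishes as `K → ∞`.
  have hK : ∀ K : ℕ, 𝔼 ε, F ε ≤ R * √(2 * d) * (2 * √W + 6) +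
      √(Fintype.card ι) * (R / 2 ^ (K + 1)) := by
    intro K
    obtain ⟨M, hM, hME⟩ := hchain K
    have hFM : ∀ ε, F ε ≤ M ε + √(Fintype.card ι) * (R / 2 ^ (K + 1)) := by
      intro ε
      refine hF ε _ fun z hz => ?_
      obtain ⟨y, hy, hzy⟩ := hNnet K z hz
      have h1 := abs_rademacherSum_le_sqrt (fun j => v z j - v y j) ε
        (r := R / 2 ^ (K + 1)) (by positivity) ((hlip z hz y (hNZ K y hy)).trans (by
          gcongr
          rwa [le_div_iff₀ hL, mul_comm] at hzy))
      rw [rademacherSum_sub] at h1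
      have h2 := abs_sub_abs_le_abs_sub (rademacherSum (v z) ε) (rademacherSum (v y) ε)
      linarith [hM ε y hy]
    refine (Finset.expect_le_expect fun ε _ => hFM ε).trans ?_
    rw [Finset.expect_add_distrib, Fintype.expect_const]
    gcongr
    refine hME.trans ?_
    gcongr
    exact sum_range_div_two_pow _ (Real.sqrt_nonneg _) _
  have hlim : Filter.Tendsto (fun K : ℕ => R * √(2 * d) * (2 * √W + 6) +
      √(Fintype.card ι) * (R / 2 ^ (K + 1))) Filter.atTop
      (nhds (R * √(2 * d) * (2 * √W + 6) + √(Fintype.card ι) * 0)) := by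
    refine tendsto_const_nhds.add (tendsto_const_nhds.mul ?_)
    have := (tendsto_pow_atTop_nhds_zero_of_lt_one (r := (1 / 2 : ℝ)) (by norm_num)
      (by norm_num)).comp (Filter.tendsto_add_atTop_nat 1)
    simpa [div_eq_mul_inv] using this.const_mul R
  rw [mul_zero, add_zero] at hlim
  exact ge_of_tendsto' hlim hK

end Chaining

/-! ### Suprema of sequences of functions -/

section Suprema

lemma bddAbove_range_abs {u : ℕ → ℝ} {b : ℝ} (h : ∀ n, |u n| ≤ b) :
    BddAbove (range fun n => |u n|) :=
  ⟨b, by rintro _ ⟨n, rfl⟩; exact h n⟩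

lemma iSup_abs_nonneg (u : ℕ → ℝ) : 0 ≤ ⨆ n, |u n| :=
  Real.iSup_nonneg fun _ => abs_nonneg _

lemma abs_iSup_abs_le {u : ℕ → ℝ} {b : ℝ} (h : ∀ n, |u n| ≤ b) : abs (⨆ n, |u n|) ≤ b := by
  rw [abs_of_nonneg (iSup_abs_nonneg u)]
  exact ciSup_le h

lemma integrable_iSup_abs {Ω : Type*} [MeasurableSpace Ω] {P : Measure Ω} [IsFiniteMeasure P]
    {u : ℕ → Ω → ℝ} {b : ℝ} (hu : ∀ n, Measurable (u n)) (h : ∀ n ω, |u n ω| ≤ b) :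
    Integrable (fun ω => ⨆ n, |u n ω|) P :=
  Integrable.of_bound (Measurable.iSup fun n => (hu n).abs).aestronglyMeasurable b
    (Filter.Eventually.of_forall fun ω => abs_iSup_abs_le fun n => h n ω)

end Suprema

/-! ### Symmetrization -/

section Symmetrization

variable {X ι : Type*} [MeasurableSpace X] [Fintype ι]

/-- Interchanging the `j`-th entries of two independent samples for all `j` with `ε j = false`
preserves their joint law. -/
lemma measurePreserving_swap_of_signs (μ : Measure X) [IsProbabilityMeasure μ] (ε : ι → Bool) :
    MeasurePreserving
      (fun w : (ι → X) × (ι → X) =>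
        ((fun j => if ε j then w.1 j else w.2 j), fun j => if ε j then w.2 j else w.1 j))
      ((Measure.pi fun _ : ι => μ).prod (Measure.pi fun _ : ι => μ))
      ((Measure.pi fun _ : ι => μ).prod (Measure.pi fun _ : ι => μ)) := by
  have he := measurePreserving_arrowProdEquivProdArrow X X ι (fun _ => μ) (fun _ => μ)
  have hf : ∀ j, MeasurePreserving (if ε j then id else Prod.swap) (μ.prod μ) (μ.prod μ) := by
    intro j
    split_ifs
    · exact MeasurePreserving.id _
    · exact Measure.measurePreserving_swap
  have h := (he.comp (measurePreserving_pi (fun _ : ι => μ.prod μ) (fun _ => μ.prod μ) hf)).comp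
    (he.symm _)
  convert h using 1
  funext w
  refine Prod.ext ?_ ?_ <;> funext j <;>
    simp only [Function.comp_apply, MeasurableEquiv.arrowProdEquivProdArrow,
      MeasurableEquiv.coe_mk, Equiv.arrowProdEquivProdArrow, MeasurableEquiv.symm_mk,
      Equiv.coe_fn_symm_mk, Equiv.coe_fn_mk] <;>
    cases ε j <;> rfl

lemma measurable_rademacherSum {Ω : Type*} [MeasurableSpace Ω] {v : Ω → ι → ℝ}
    (hv : ∀ j, Measurable fun ω => v ω j) (ε : ι → Bool) :
    Measurable fun ω => rademacherSum (v ω) ε := by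
  refine Finset.measurable_sum _ fun j _ => ?_
  split_ifs
  exacts [hv j, (hv j).neg]

lemma abs_rademacherSum_le_card_mul {v : ι → ℝ} {B : ℝ} (h : ∀ j, |v j| ≤ B) (ε : ι → Bool) :
    |rademacherSum v ε| ≤ Fintype.card ι * B := by
  refine (abs_rademacherSum_le v ε).trans ((Finset.sum_le_sum fun j _ => h j).trans ?_)
  simp

/-- Symmetrization, for a uniformly bounded sequence of functions and any fixed choice of
signs: the means are replaced by an independent copy of the sample, exchanging the two samples in
some of the coordinates changes nothing, and the triangle inequality separates them. -/
theorem integral_iSup_abs_sum_sub_integral_le (μ : Measure X) [IsProbabilityMeasure μ]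
    {g : ℕ → X → ℝ} {B : ℝ} (hg : ∀ n, Measurable (g n)) (hB : ∀ n x, |g n x| ≤ B)
    (ε : ι → Bool) :
    ∫ ω : ι → X, ⨆ n, |∑ j, (g n (ω j) - ∫ x, g n x ∂μ)| ∂(Measure.pi fun _ => μ) ≤
      2 * ∫ ω : ι → X, ⨆ n, |rademacherSum (fun j => g n (ω j)) ε|
        ∂(Measure.pi fun _ => μ) := by
  set ν : Measure (ι → X) := Measure.pi fun _ => μ with hν
  have hgj : ∀ n (j : ι), Measurable fun ω : ι → X => g n (ω j) := fun n j =>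
    (hg n).comp (measurable_pi_apply j)
  have hsum : ∀ (v : ι → ℝ) (b : ℝ), (∀ j, |v j| ≤ b) → |∑ j, v j| ≤ Fintype.card ι * b := by
    intro v b hv
    refine (Finset.abs_sum_le_sum_abs _ _).trans ((Finset.sum_le_sum fun j _ => hv j).trans ?_)
    simp
  have hint : ∀ n, Integrable (g n) μ := fun n =>
    Integrable.of_bound (hg n).aestronglyMeasurable B (Filter.Eventually.of_forall (hB n))
  have hmean : ∀ n, |∫ x, g n x ∂μ| ≤ B := fun n => by
    have := norm_integral_le_of_norm_le_const (μ := μ) (f := g n)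
      (Filter.Eventually.of_forall (hB n))
    simpa using this
  have hdist : ∀ n (ω ω' : ι → X) j, |g n (ω j) - g n (ω' j)| ≤ B + B := fun n ω ω' j =>
    (abs_sub _ _).trans (add_le_add (hB n _) (hB n _))
  -- The supremum of the differences between the two samples.
  set Q : (ι → X) × (ι → X) → ℝ := fun w => ⨆ n, |∑ j, (g n (w.1 j) - g n (w.2 j))| with hQ
  have hQint : Integrable Q (ν.prod ν) := by
    refine integrable_iSup_abs (b := Fintype.card ι * (B + B)) (fun n => ?_)
      fun n w => hsum _ _ (hdist n w.1 w.2)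
    exact Finset.measurable_sum _ fun j _ =>
      ((hgj n j).comp measurable_fst).sub ((hgj n j).comp measurable_snd)
  have hpt : ∀ ω, ⨆ n, |∑ j, (g n (ω j) - ∫ x, g n x ∂μ)| ≤ ∫ ω', Q (ω, ω') ∂ν := by
    intro ω
    refine ciSup_le fun n => ?_
    have hI : ∀ j, Integrable (fun ω' : ι → X => g n (ω j) - g n (ω' j)) ν := fun j =>
      Integrable.of_bound ((measurable_const.sub (hgj n j)).aestronglyMeasurable) (B + B)
        (Filter.Eventually.of_forall fun ω' => hdist n ω ω' j)
    have h1 : ∑ j, (g n (ω j) - ∫ x, g n x ∂μ)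
        = ∫ ω', ∑ j, (g n (ω j) - g n (ω' j)) ∂ν := by
      rw [integral_finsetSum _ fun j _ => hI j]
      refine Finset.sum_congr rfl fun j _ => ?_
      have h2 : Integrable (fun ω' : ι → X => g n (ω' j)) ν :=
        Integrable.of_bound (hgj n j).aestronglyMeasurable B
          (Filter.Eventually.of_forall fun ω' => hB n _)
      have h3 : ∫ ω' : ι → X, g n (ω' j) ∂ν = ∫ x, g n x ∂μ := by
        have hev := measurePreserving_eval (fun _ : ι => μ) j
        rw [← hev.map_eq, integral_map hev.measurable.aemeasurable
          (hg n).aestronglyMeasurable]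
      rw [integral_sub (integrable_const _) h2, h3]
      simp
    rw [h1]
    refine (abs_integral_le_integral_abs).trans ?_
    refine integral_mono (integrable_finsetSum _ fun j _ => hI j).abs ?_ fun ω' => ?_
    · refine integrable_iSup_abs (b := Fintype.card ι * (B + B)) (fun n => ?_)
        fun n w => hsum _ _ (hdist n ω w)
      exact Finset.measurable_sum _ fun j _ => Measurable.const_sub (hgj n j) (g n (ω j))
    · exact le_ciSup (bddAbove_range_abs fun n => hsum _ _ (hdist n ω ω')) n
  have hS : ∫ ω : ι → X, ⨆ n, |∑ j, (g n (ω j) - ∫ x, g n x ∂μ)| ∂ν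
      ≤ ∫ w, Q w ∂(ν.prod ν) := by
    rw [integral_prod _ hQint]
    refine integral_mono ?_ hQint.integral_prod_left hpt
    refine integrable_iSup_abs (b := Fintype.card ι * (B + B)) (fun n => ?_)
      fun n w => hsum _ _ fun j => (abs_sub _ _).trans (add_le_add (hB n _) (hmean n))
    exact Finset.measurable_sum _ fun j _ => (hgj n j).sub measurable_const
  set Rε : (ι → X) → ℝ := fun ω => ⨆ n, |rademacherSum (fun j => g n (ω j)) ε| with hR
  have hRint : Integrable Rε ν :=
    integrable_iSup_abs (b := Fintype.card ι * B)
      (fun n => measurable_rademacherSum (fun j => hgj n j) ε)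
      fun n ω => abs_rademacherSum_le_card_mul (fun j => hB n _) ε
  have hswap := measurePreserving_swap_of_signs (ι := ι) μ ε
  have hQswap : ∫ w, Q w ∂(ν.prod ν) ≤ ∫ w, (Rε w.1 + Rε w.2) ∂(ν.prod ν) := by
    have h1 : Integrable Q ((ν.prod ν).map _) := hswap.map_eq.symm ▸ hQint
    rw [← hswap.map_eq, integral_map hswap.measurable.aemeasurable h1.aestronglyMeasurable,
      hswap.map_eq]
    refine integral_mono (h1.comp_measurable hswap.measurable)
      ((hRint.comp_fst ν).add (hRint.comp_snd ν)) fun w => ciSup_le fun n => ?_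
    have h2 : ∑ j, (g n (if ε j then w.1 j else w.2 j) - g n (if ε j then w.2 j else w.1 j))
        = rademacherSum (fun j => g n (w.1 j)) ε - rademacherSum (fun j => g n (w.2 j)) ε := by
      rw [← rademacherSum_sub, rademacherSum]
      refine Finset.sum_congr rfl fun j _ => ?_
      split_ifs <;> ring
    have hle : ∀ ω : ι → X, |rademacherSum (fun j => g n (ω j)) ε| ≤ Rε ω := fun ω =>
      le_ciSup (bddAbove_range_abs
        fun n => abs_rademacherSum_le_card_mul (fun j => hB n (ω j)) ε) n
    simp only [h2]
    exact (abs_sub _ _).trans (add_le_add (hle _) (hle _))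
  refine hS.trans (hQswap.trans_eq ?_)
  rw [integral_add (hRint.comp_fst ν) (hRint.comp_snd ν), integral_fun_fst, integral_fun_snd]
  simp [two_mul]

end Symmetrization

/-! ### Bounded differences -/

section BoundedDifferences

open ProbabilityTheory

variable {X : Type*} [MeasurableSpace X]

lemma integral_pi_fin_succ (μ : Measure X) [IsProbabilityMeasure μ] {n : ℕ}
    {F : (Fin (n + 1) → X) → ℝ} (hF : Integrable F (Measure.pi fun _ => μ)) :
    Integrable (fun w : X × (Fin n → X) => F (Fin.cons w.1 w.2))
        (μ.prod (Measure.pi fun _ => μ)) ∧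
      ∫ ω, F ω ∂(Measure.pi fun _ => μ) =
        ∫ x, ∫ ω, F (Fin.cons x ω) ∂(Measure.pi fun _ : Fin n => μ) ∂μ := by
  have h := (measurePreserving_piFinSuccAbove (fun _ : Fin (n + 1) => μ) 0).symm
  have he : ⇑(MeasurableEquiv.piFinSuccAbove (fun _ : Fin (n + 1) => X) 0).symm =
      fun w : X × (Fin n → X) => Fin.cons w.1 w.2 := by
    funext w
    exact Fin.insertNth_zero' _ _
  have h1 : Integrable (fun w : X × (Fin n → X) => F (Fin.cons w.1 w.2))
      (μ.prod (Measure.pi fun _ => μ)) := by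
    have := h.integrable_comp_of_integrable hF
    rwa [he] at this
  refine ⟨h1, ?_⟩
  rw [← integral_prod _ h1, ← h.integral_comp', he]

/-- McDiarmid's inequality in moment generating form: a function of `n` independent variables
that changes by at most `c` when one of them is changed is sub-Gaussian with variance proxy
`n c² / 4`. The variables are integrated out one at a time, each by Hoeffding's lemma. -/
theorem hasSubgaussianMGF_of_bounded_differences (μ : Measure X) [IsProbabilityMeasure μ]
    (c : NNReal) {B : ℝ} (n : ℕ) (f : (Fin n → X) → ℝ) (hf : Measurable f)
    (hB : ∀ ω, |f ω| ≤ B) (hc : ∀ ω j x, |f (Function.update ω j x) - f ω| ≤ c) :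
    HasSubgaussianMGF (fun ω => f ω - ∫ ω, f ω ∂(Measure.pi fun _ => μ))
      (n * (c / 2) ^ 2) (Measure.pi fun _ => μ) := by
  induction n with
  | zero =>
    have h : (fun ω => f ω - ∫ ω, f ω ∂(Measure.pi fun _ : Fin 0 => μ)) = fun _ => 0 := by
      funext ω
      have : f = fun _ => f ω := funext fun ω' => by rw [Subsingleton.elim ω' ω]
      rw [this]
      simp
    rw [h]
    simp
  | succ n ih =>
    have hcons : Measurable fun w : X × (Fin n → X) => (Fin.cons w.1 w.2 : Fin (n + 1) → X) := by
      refine measurable_pi_iff.2 fun j => ?_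
      refine Fin.cases ?_ (fun j => ?_) j
      · simpa using measurable_fst
      · simpa only [Fin.cons_succ] using (measurable_pi_apply j).fun_comp measurable_snd
    have hX : Nonempty X := nonempty_of_isProbabilityMeasure μ
    set ν : Measure (Fin n → X) := Measure.pi fun _ => μ with hν
    set N : Measure (Fin (n + 1) → X) := Measure.pi fun _ => μ with hN
    have hfint : Integrable f N :=
      Integrable.of_bound hf.aestronglyMeasurable B (Filter.Eventually.of_forall hB)
    obtain ⟨hfp, hfI⟩ := integral_pi_fin_succ μ hfint
    have hfx : ∀ x, Measurable fun ω : Fin n → X => f (Fin.cons x ω) := fun x =>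
      hf.comp (hcons.comp measurable_prodMk_left)
    have hfxint : ∀ x, Integrable (fun ω : Fin n → X => f (Fin.cons x ω)) ν := fun x =>
      Integrable.of_bound (hfx x).aestronglyMeasurable B
        (Filter.Eventually.of_forall fun ω => hB _)
    -- The conditional expectation of `f` given the first variable.
    set g : X → ℝ := fun x => ∫ ω, f (Fin.cons x ω) ∂ν with hg
    have hgm : AEMeasurable g μ := hfp.integral_prod_left.aestronglyMeasurable.aemeasurable
    have hgB : ∀ x, |g x| ≤ B := fun x => by
      have := norm_integral_le_of_norm_le_const (μ := ν)
        (f := fun ω => f (Fin.cons x ω)) (Filter.Eventually.of_forall fun ω => hB (Fin.cons x ω))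
      simpa using this
    have hgc : ∀ x y, g x - g y ≤ c := by
      intro x y
      simp only [hg]
      rw [← integral_sub (hfxint x) (hfxint y)]
      refine (integral_mono ((hfxint x).sub (hfxint y)) (integrable_const (c : ℝ))
        fun ω => ?_).trans_eq (by simp)
      have := hc (Fin.cons y ω) 0 x
      rw [Fin.update_cons_zero] at this
      exact (le_abs_self _).trans this
    have hgbdd : BddBelow (range g) := ⟨-B, by rintro _ ⟨x, rfl⟩; exact (abs_le.1 (hgB x)).1⟩
    have hgIcc : ∀ x, g x ∈ Icc (⨅ x, g x) ((⨅ x, g x) + c) := fun x => by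
      refine ⟨ciInf_le hgbdd x, ?_⟩
      have : g x - c ≤ ⨅ x, g x := le_ciInf fun y => by linarith [hgc x y]
      linarith
    have hgsub := hasSubgaussianMGF_of_mem_Icc hgm (Filter.Eventually.of_forall hgIcc)
    have hcc : ‖(⨅ x, g x) + (c : ℝ) - ⨅ x, g x‖₊ = c := by
      rw [add_sub_cancel_left]; exact NNReal.nnnorm_eq c
    rw [hcc] at hgsub
    have hih : ∀ x, HasSubgaussianMGF (fun ω => f (Fin.cons x ω) - g x) (n * (c / 2) ^ 2) ν := by
      intro x
      refine ih _ (hfx x) (fun ω => hB _) fun ω j y => ?_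
      have := hc (Fin.cons x ω) j.succ y
      rwa [← Fin.cons_update] at this
    set m₀ : ℝ := ∫ ω, f ω ∂N with hm₀
    have hexpint : ∀ t : ℝ, Integrable (fun ω => Real.exp (t * (f ω - m₀))) N := fun t => by
      refine Integrable.of_bound (by fun_prop) (Real.exp (|t| * (B + |m₀|)))
        (Filter.Eventually.of_forall fun ω => ?_)
      rw [Real.norm_eq_abs, Real.abs_exp]
      refine Real.exp_le_exp.2 ((le_abs_self _).trans ?_)
      rw [abs_mul]
      gcongr
      exact (abs_sub _ _).trans (add_le_add (hB ω) le_rfl)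
    refine ⟨hexpint, fun t => ?_⟩
    obtain ⟨hp, hI⟩ := integral_pi_fin_succ μ (hexpint t)
    rw [mgf, hI]
    have hinner : ∀ x, ∫ ω, Real.exp (t * (f (Fin.cons x ω) - m₀)) ∂ν ≤
        Real.exp (n * (c / 2) ^ 2 * t ^ 2 / 2) * Real.exp (t * (g x - m₀)) := by
      intro x
      have h1 : ∀ ω : Fin n → X, Real.exp (t * (f (Fin.cons x ω) - m₀)) =
          Real.exp (t * (f (Fin.cons x ω) - g x)) * Real.exp (t * (g x - m₀)) := fun ω => by
        rw [← Real.exp_add]; ring_nf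
      simp only [h1]
      rw [integral_mul_const]
      have h2 := (hih x).mgf_le t
      rw [mgf] at h2
      push_cast at h2
      gcongr
    have hm₀g : m₀ = ∫ x, g x ∂μ := hfI
    have h3 := hgsub.mgf_le t
    rw [mgf] at h3
    simp only [← hm₀g] at h3
    have h4 := hgsub.integrable_exp_mul t
    simp only [← hm₀g] at h4
    refine (integral_mono hp.integral_prod_left (h4.const_mul _) hinner).trans ?_
    rw [integral_const_mul]
    refine (mul_le_mul_of_nonneg_left h3 (Real.exp_pos _).le).trans_eq ?_
    rw [← Real.exp_add]
    push_cast
    congr 1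
    ring

end BoundedDifferences

/-! ### Derivatives of the kernel -/

section Derivatives

variable {d : ℕ}

lemma monomial_add (p q : Fin d → ℕ) (ω : Space d) :
    monomial (p + q) ω = monomial p ω * monomial q ω := by
  simp only [monomial, Pi.add_apply, pow_add, Finset.prod_mul_distrib]

lemma monomial_single (i : Fin d) (ω : Space d) : monomial (Pi.single i 1) ω = ω i := by
  rw [monomial, Finset.prod_eq_single i]
  · simp
  · intro j _ hj
    simp [hj]
  · simp

lemma order_add (p q : Fin d → ℕ) : order (p + q) = order p + order q :=
  Finset.sum_add_distrib

lemma order_single (i : Fin d) : order (Pi.single i 1 : Fin d → ℕ) = 1 := by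
  simp [order]

lemma abs_monomial_neg (q : Fin d → ℕ) (ω : Space d) : |monomial q (-ω)| = |monomial q ω| := by
  simp only [monomial, Finset.abs_prod, abs_pow, PiLp.neg_apply, abs_neg]

lemma continuous_monomial (p : Fin d → ℕ) : Continuous (monomial p) := by
  unfold monomial
  fun_prop

/-- The amplitude `ω^p (-ω)^q` of the random Fourier features. -/
noncomputable def amplitude (p q : Fin d → ℕ) (ω : Space d) : ℝ := monomial p ω * monomial q (-ω)

lemma abs_amplitude (p q : Fin d → ℕ) (ω : Space d) :
    |amplitude p q ω| = |monomial (p + q) ω| := by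
  rw [amplitude, abs_mul, abs_monomial_neg, monomial_add, abs_mul]

lemma continuous_amplitude (p q : Fin d → ℕ) : Continuous (amplitude p q) :=
  (continuous_monomial p).mul ((continuous_monomial q).comp continuous_neg)

lemma amplitude_add_single_left (p q : Fin d → ℕ) (i : Fin d) (ω : Space d) :
    amplitude (p + Pi.single i 1) q ω = amplitude p q ω * ω i := by
  rw [amplitude, amplitude, monomial_add, monomial_single]
  ring

lemma amplitude_add_single_right (p q : Fin d → ℕ) (i : Fin d) (ω : Space d) :
    amplitude p (q + Pi.single i 1) ω = amplitude p q ω * -ω i := by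
  rw [amplitude, amplitude, monomial_add, monomial_single, PiLp.neg_apply]
  ring

lemma integrable_amplitude {Λ : Measure (Space d)} {p q : Fin d → ℕ}
    (h : Integrable (monomial (p + q)) Λ) : Integrable (amplitude p q) Λ :=
  h.mono (continuous_amplitude p q).aestronglyMeasurable
    (Filter.Eventually.of_forall fun ω => by
      rw [Real.norm_eq_abs, Real.norm_eq_abs, abs_amplitude])

lemma hasDerivAt_h (n : ℕ) (v : ℝ) : HasDerivAt (h n) (h (n + 1) v) v := by
  have h1 := (Real.hasDerivAt_cos (n * Real.pi / 2 + v)).comp v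
    ((hasDerivAt_id v).const_add (n * Real.pi / 2))
  have h2 : h (n + 1) v = -Real.sin (n * Real.pi / 2 + v) * 1 := by
    rw [h, mul_one, ← Real.cos_add_pi_div_two]
    congr 1
    push_cast
    ring
  rw [h2]
  exact h1

lemma abs_h_le_one (n : ℕ) (v : ℝ) : |h n v| ≤ 1 := Real.abs_cos_le_one _

lemma continuous_h (n : ℕ) : Continuous (h n) := by
  unfold h
  fun_prop

lemma abs_h_sub_h_le (n : ℕ) (v w : ℝ) : |h n v - h n w| ≤ |v - w| := by
  have := Convex.norm_image_sub_le_of_norm_hasDerivWithin_le (f := h n) (f' := h (n + 1)) (C := 1)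
    (s := univ) (fun x _ => (hasDerivAt_h n x).hasDerivWithinAt) (fun x _ => abs_h_le_one _ _)
    convex_univ (mem_univ w) (mem_univ v)
  simpa using this

lemma integrable_mul_h {Λ : Measure (Space d)} {a : Space d → ℝ} (ha : Integrable a Λ) (n : ℕ)
    (z : Space d) : Integrable (fun ω => a ω * h n (inner ℝ ω z)) Λ := by
  refine ha.mono (ha.aestronglyMeasurable.mul
    ((continuous_h n).comp (by fun_prop)).aestronglyMeasurable)
    (Filter.Eventually.of_forall fun ω => ?_)
  rw [norm_mul]
  exact mul_le_of_le_one_right (norm_nonneg _) (abs_h_le_one _ _)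

/-- Differentiation under the integral sign in the direction `v`, dominated by
`|a ω * ⟪ω, v⟫|` because the functions `h n` are bounded by `1`. -/
lemma hasLineDerivAt_integral_mul_h {Λ : Measure (Space d)} {a : Space d → ℝ}
    (ha : Integrable a Λ) (n : ℕ) (z v : Space d)
    (hav : Integrable (fun ω => a ω * inner ℝ ω v) Λ) :
    HasLineDerivAt ℝ (fun z => ∫ ω, a ω * h n (inner ℝ ω z) ∂Λ)
      (∫ ω, a ω * inner ℝ ω v * h (n + 1) (inner ℝ ω z) ∂Λ) z v := by
  have key := hasDerivAt_integral_of_dominated_loc_of_deriv_le (μ := Λ) (𝕜 := ℝ) (s := univ)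
    (x₀ := 0) (F := fun t ω => a ω * h n (inner ℝ ω (z + t • v)))
    (F' := fun t ω => a ω * inner ℝ ω v * h (n + 1) (inner ℝ ω (z + t • v)))
    (bound := fun ω => |a ω * inner ℝ ω v|) Filter.univ_mem
    (Filter.Eventually.of_forall fun t => (integrable_mul_h ha n _).aestronglyMeasurable)
    (integrable_mul_h ha n _) (integrable_mul_h hav (n + 1) _).aestronglyMeasurable
    (Filter.Eventually.of_forall fun ω t _ => ?_) hav.abs
    (Filter.Eventually.of_forall fun ω t _ => ?_)
  · have h2 := key.2
    simp only [zero_smul, add_zero] at h2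
    exact h2
  · rw [norm_mul]
    exact mul_le_of_le_one_right (norm_nonneg _) (abs_h_le_one _ _)
  · have h1 : HasDerivAt (fun t : ℝ => inner ℝ ω (z + t • v)) (inner ℝ ω v) t := by
      simp only [inner_add_right, inner_smul_right]
      simpa using ((hasDerivAt_id t).mul_const (inner ℝ ω v)).const_add (inner ℝ ω z)
    have h2 := ((hasDerivAt_h n _).comp t h1).const_mul (a ω)
    exact h2.congr_deriv (by ring)

/-- The mixed partial derivative of order `(p, q)` of the kernel with spectral measure `Λ`,
obtained by differentiating under the integral sign. -/
noncomputable def kernelDeriv (Λ : Measure (Space d)) (p q : Fin d → ℕ) (x y : Space d) : ℝ :=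
  ∫ ω, amplitude p q ω * h (order (p + q)) (inner ℝ ω (x - y)) ∂Λ

lemma hasLineDerivAt_kernelDeriv_left {Λ : Measure (Space d)} {p q : Fin d → ℕ} (i : Fin d)
    (h0 : Integrable (monomial (p + q)) Λ)
    (h1 : Integrable (monomial (p + Pi.single i 1 + q)) Λ) (x y : Space d) :
    HasLineDerivAt ℝ (fun u => kernelDeriv Λ p q u y)
      (kernelDeriv Λ (p + Pi.single i 1) q x y) x (EuclideanSpace.single i 1) := by
  have hin : ∀ ω : Space d, inner ℝ ω (EuclideanSpace.single i (1 : ℝ)) = ω i := fun ω => by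
    simp [EuclideanSpace.inner_single_right]
  have key := hasLineDerivAt_integral_mul_h (integrable_amplitude h0) (order (p + q)) (x - y)
    (EuclideanSpace.single i 1) (by
      simpa only [hin, ← amplitude_add_single_left] using integrable_amplitude h1)
  simp only [hin, ← amplitude_add_single_left] at key
  have hord : order (p + Pi.single i 1 + q) = order (p + q) + 1 := by
    simp only [order_add, order_single]; ring
  unfold HasLineDerivAt at key ⊢
  simp only [kernelDeriv, hord]
  convert key using 6
  congr 1
  abel

lemma hasLineDerivAt_kernelDeriv_right {Λ : Measure (Space d)} {p q : Fin d → ℕ} (i : Fin d)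
    (h0 : Integrable (monomial (p + q)) Λ)
    (h1 : Integrable (monomial (p + (q + Pi.single i 1))) Λ) (x y : Space d) :
    HasLineDerivAt ℝ (fun v => kernelDeriv Λ p q x v)
      (kernelDeriv Λ p (q + Pi.single i 1) x y) y (EuclideanSpace.single i 1) := by
  have hin : ∀ ω : Space d, inner ℝ ω (-EuclideanSpace.single i (1 : ℝ)) = -ω i := fun ω => by
    simp [EuclideanSpace.inner_single_right]
  have key := hasLineDerivAt_integral_mul_h (integrable_amplitude h0) (order (p + q)) (x - y)
    (-EuclideanSpace.single i 1) (by
      simpa only [hin, ← amplitude_add_single_right] using integrable_amplitude h1)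
  simp only [hin, ← amplitude_add_single_right] at key
  have hord : order (p + (q + Pi.single i 1)) = order (p + q) + 1 := by
    simp only [order_add, order_single]; ring
  unfold HasLineDerivAt at key ⊢
  simp only [kernelDeriv, hord]
  convert key using 6
  rw [smul_neg]
  congr 1
  abel

lemma eq_kernelDeriv_zero {k : Space d → Space d → ℝ} {Λ : Measure (Space d)}
    [IsFiniteMeasure Λ] (hk : IsSpectralMeasure k Λ) : k = kernelDeriv Λ 0 0 := by
  funext x y
  have h1 := congrArg Complex.re (hk x y)
  have hint : Integrable (fun ω : Space d =>
      Complex.exp ((inner ℝ ω (x - y) : ℝ) * Complex.I)) Λ :=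
    Integrable.of_bound (Continuous.aestronglyMeasurable (by fun_prop)) 1
      (Filter.Eventually.of_forall fun ω => by rw [Complex.norm_exp_ofReal_mul_I])
  rw [Complex.ofReal_re, charFun_apply] at h1
  rw [h1]
  have h2 := integral_re hint
  simp only [RCLike.re_to_complex] at h2
  rw [← h2]
  simp [kernelDeriv, amplitude, monomial, order, h, Complex.exp_ofReal_mul_I_re]

lemma hasMixedPartial_kernelDeriv {k : Space d → Space d → ℝ} {Λ : Measure (Space d)}
    [IsFiniteMeasure Λ] (hk : IsSpectralMeasure k Λ) (n : ℕ) (p q : Fin d → ℕ)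
    (hn : order (p + q) = n) (hm : ∀ r ≤ p + q, Integrable (monomial r) Λ) :
    HasMixedPartial k p q (kernelDeriv Λ p q) := by
  induction n generalizing p q with
  | zero =>
    have h0 : ∀ i, p i + q i = 0 := fun i => by
      have := (Finset.sum_eq_zero_iff.1 hn) i (Finset.mem_univ i)
      simpa using this
    obtain rfl : p = 0 := funext fun i => by have := h0 i; simp only [Pi.zero_apply]; omega
    obtain rfl : q = 0 := funext fun i => by have := h0 i; simp only [Pi.zero_apply]; omega
    rw [← eq_kernelDeriv_zero hk]
    exact .zero
  | succ n ih =>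
    obtain ⟨i, hi⟩ : ∃ i, (p + q) i ≠ 0 := by
      by_contra! hcon
      have : order (p + q) = 0 := Finset.sum_eq_zero fun i _ => hcon i
      omega
    have hdec : ∀ r : Fin d → ℕ, r i ≠ 0 → ∃ r', r = r' + Pi.single i 1 := fun r hr =>
      ⟨r - Pi.single i 1, (tsub_add_cancel_of_le fun j => by
        by_cases hj : j = i
        · subst hj; simpa using Nat.one_le_iff_ne_zero.2 hr
        · simp [hj]).symm⟩
    by_cases hp : p i = 0
    · obtain ⟨q', rfl⟩ := hdec q (by simpa [hp] using hi)
      have hle : p + q' ≤ p + (q' + Pi.single i 1) := by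
        rw [← add_assoc]; exact le_self_add
      refine .right i (ih p q' ?_ fun r hr => hm r (hr.trans hle)) fun x y =>
        hasLineDerivAt_kernelDeriv_right i (hm _ hle) (hm _ le_rfl) x y
      simp only [order_add, order_single] at hn ⊢
      omega
    · obtain ⟨p', rfl⟩ := hdec p hp
      have hle : p' + q ≤ p' + Pi.single i 1 + q := by
        rw [add_right_comm]; exact le_self_add
      refine .left i (ih p' q ?_ fun r hr => hm r (hr.trans hle)) fun x y =>
        hasLineDerivAt_kernelDeriv_left i (hm _ hle) (hm _ le_rfl) x y
      simp only [order_add, order_single] at hn ⊢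
      omega

/-- Whatever the order of the differentiations, the result is `kernelDeriv`. -/
lemma HasMixedPartial.eq_kernelDeriv {k : Space d → Space d → ℝ} {Λ : Measure (Space d)}
    [IsFiniteMeasure Λ] (hk : IsSpectralMeasure k Λ) {p q : Fin d → ℕ}
    {D : Space d → Space d → ℝ} (hD : HasMixedPartial k p q D)
    (hm : ∀ r ≤ p + q, Integrable (monomial r) Λ) : D = kernelDeriv Λ p q := by
  induction hD with
  | zero => exact eq_kernelDeriv_zero hk
  | @left p q D D' i _ hD' ih =>
    have hle : p + q ≤ p + Pi.single i 1 + q := by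
      rw [add_right_comm]; exact le_self_add
    obtain rfl := ih fun r hr => hm r (hr.trans hle)
    funext x y
    exact (hD' x y).unique
      (hasLineDerivAt_kernelDeriv_left i (hm _ hle) (hm _ le_rfl) x y)
  | @right p q D D' i _ hD' ih =>
    have hle : p + q ≤ p + (q + Pi.single i 1) := by
      rw [← add_assoc]; exact le_self_add
    obtain rfl := ih fun r hr => hm r (hr.trans hle)
    funext x y
    exact (hD' x y).unique
      (hasLineDerivAt_kernelDeriv_right i (hm _ hle) (hm _ le_rfl) x y)

end Derivatives

/-! ### Concentration and Jensen inequalities -/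

section EmpiricalProcess

open ProbabilityTheory

variable {X : Type*} [MeasurableSpace X]

/-- Concentration of the uniform deviation of empirical means around a bound `b` for its
expectation: replacing one observation changes the deviation by at most `2 T / m`. -/
theorem measure_add_le_iSup_abs_sum_sub_integral_le (μ : Measure X) [IsProbabilityMeasure μ]
    {g : ℕ → X → ℝ} {T b τ : ℝ} {m : ℕ} (hm : 0 < m) (hT : 0 < T) (hτ : 0 < τ)
    (hg : ∀ n, Measurable (g n)) (hgT : ∀ n x, |g n x| ≤ T)
    (hb : ∫ ω : Fin m → X, ⨆ n, |∑ j, (g n (ω j) - ∫ x, g n x ∂μ)| ∂(Measure.pi fun _ => μ)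
      ≤ m * b) :
    Measure.pi (fun _ : Fin m => μ) {ω | b + T * √(2 * τ / m) ≤
      (1 / (m : ℝ)) * ⨆ n, |∑ j, (g n (ω j) - ∫ x, g n x ∂μ)|} ≤
        ENNReal.ofReal (Real.exp (-τ)) := by
  have hm0 : (0 : ℝ) < m := by exact_mod_cast hm
  set ν : Measure (Fin m → X) := Measure.pi fun _ => μ
  set F : (Fin m → X) → ℝ := fun ω => ⨆ n, |∑ j, (g n (ω j) - ∫ x, g n x ∂μ)| with hF
  have hmean : ∀ n, |∫ x, g n x ∂μ| ≤ T := fun n => by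
    have := norm_integral_le_of_norm_le_const (μ := μ) (f := g n)
      (Filter.Eventually.of_forall (hgT n))
    simpa using this
  have hbd : ∀ n (ω : Fin m → X), |∑ j, (g n (ω j) - ∫ x, g n x ∂μ)| ≤ m * (T + T) := by
    intro n ω
    refine (Finset.abs_sum_le_sum_abs _ _).trans ((Finset.sum_le_sum fun j _ =>
      (abs_sub _ _).trans (add_le_add (hgT n _) (hmean n))).trans_eq ?_)
    rw [Finset.sum_const, Finset.card_univ, Fintype.card_fin, nsmul_eq_mul]
  have hFm : Measurable F := by
    refine Measurable.iSup fun n => (Finset.measurable_sum _ fun j _ => ?_).abs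
    exact ((hg n).comp (measurable_pi_apply j)).sub measurable_const
  have hFB : ∀ ω, |F ω| ≤ m * (T + T) := fun ω => abs_iSup_abs_le fun n => hbd n ω
  have hle : ∀ ω j x, F (Function.update ω j x) ≤ F ω + 2 * T := by
    intro ω j x
    refine ciSup_le fun n => ?_
    have h1 : ∑ i, (g n (Function.update ω j x i) - ∫ x, g n x ∂μ)
        = ∑ i, (g n (ω i) - ∫ x, g n x ∂μ) + (g n x - g n (ω j)) := by
      rw [← sub_eq_iff_eq_add', ← Finset.sum_sub_distrib, Finset.sum_eq_single j]
      · simp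
      · intro i _ hi
        simp [hi]
      · simp
    rw [h1]
    refine (abs_add_le _ _).trans (add_le_add ?_ ?_)
    · exact le_ciSup (bddAbove_range_abs fun n => hbd n ω) n
    · rw [two_mul]
      exact (abs_sub _ _).trans (add_le_add (hgT n _) (hgT n _))
  obtain ⟨c, hc⟩ : ∃ c : NNReal, (c : ℝ) = 2 * T := ⟨⟨2 * T, by positivity⟩, rfl⟩
  have hdiff : ∀ ω j x, |F (Function.update ω j x) - F ω| ≤ c := by
    intro ω j x
    have h1 := hle (Function.update ω j x) j (ω j)
    rw [Function.update_idem, Function.update_eq_self] at h1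
    rw [hc, abs_le]
    constructor <;> linarith [hle ω j x]
  have hsub := hasSubgaussianMGF_of_bounded_differences μ c m F hFm hFB hdiff
  set s : ℝ := √(2 * τ / m) with hs
  have hs2 : s ^ 2 = 2 * τ / m := Real.sq_sqrt (by positivity)
  have htail := hsub.measure_ge_le (ε := m * (T * s)) (by positivity)
  have hexp : -(m * (T * s)) ^ 2 / (2 * ((m * (c / 2) ^ 2 : NNReal) : ℝ)) = -τ := by
    push_cast
    rw [hc, mul_pow, mul_pow, hs2]
    field_simp
  rw [hexp] at htail
  have hsubset : {ω | b + T * s ≤ (1 / (m : ℝ)) * F ω} ⊆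
      {ω | m * (T * s) ≤ F ω - ∫ ω, F ω ∂ν} := by
    intro ω hω
    simp only [mem_ofPred_eq] at hω ⊢
    rw [one_div, inv_mul_eq_div, le_div_iff₀ hm0] at hω
    linarith
  refine (measure_mono hsubset).trans ?_
  rw [← ofReal_measureReal]
  exact ENNReal.ofReal_le_ofReal htail

lemma integral_const_add_const_mul (μ : Measure X) [IsProbabilityMeasure μ] {f : X → ℝ}
    (hf : Integrable f μ) (α β : ℝ) :
    Integrable (fun x => α + β * f x) μ ∧ ∫ x, (α + β * f x) ∂μ = α + β * ∫ x, f x ∂μ := by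
  refine ⟨(integrable_const _).add (hf.const_mul β), ?_⟩
  rw [integral_add (integrable_const _) (hf.const_mul β), integral_const_mul]
  simp

/-- Jensen's inequality for the square root. -/
lemma integral_sqrt_le_sqrt_integral (μ : Measure X) [IsProbabilityMeasure μ] {f : X → ℝ}
    (hf : Integrable f μ) (h0 : ∀ x, 0 ≤ f x) :
    Integrable (fun x => √(f x)) μ ∧ ∫ x, √(f x) ∂μ ≤ √(∫ x, f x ∂μ) := by
  have hi : Integrable (fun x => √(f x)) μ := by
    refine ((integrable_const (1 : ℝ)).add hf).mono
      (Real.continuous_sqrt.comp_aestronglyMeasurable hf.aestronglyMeasurable)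
      (Filter.Eventually.of_forall fun x => ?_)
    have := h0 x
    simp only [Pi.add_apply]
    rw [Real.norm_of_nonneg (Real.sqrt_nonneg _), Real.norm_of_nonneg (by positivity)]
    exact Real.sqrt_le_iff.2 ⟨by positivity, by nlinarith⟩
  exact ⟨hi, Real.strictConcaveOn_sqrt.concaveOn.le_map_integral Real.continuous_sqrt.continuousOn
    isClosed_Ici (Filter.Eventually.of_forall h0) hf hi⟩

/-- Jensen's inequality for the concave function `t ↦ √(log (1 + √t))`. -/
lemma integral_sqrt_log_one_add_sqrt_le (μ : Measure X) [IsProbabilityMeasure μ] {f : X → ℝ}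
    (hf : Integrable f μ) (h0 : ∀ x, 0 ≤ f x) :
    Integrable (fun x => √(Real.log (1 + √(f x)))) μ ∧
      ∫ x, √(Real.log (1 + √(f x))) ∂μ ≤ √(Real.log (1 + √(∫ x, f x ∂μ))) := by
  obtain ⟨hi, hle⟩ := integral_sqrt_le_sqrt_integral μ hf h0
  have hlog0 : ∀ x, 0 ≤ Real.log (1 + √(f x)) := fun x =>
    Real.log_nonneg (by linarith [Real.sqrt_nonneg (f x)])
  have hlogi : Integrable (fun x => Real.log (1 + √(f x))) μ := by
    refine hi.mono (Real.measurable_log.comp_aemeasurable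
      (hi.aestronglyMeasurable.aemeasurable.const_add 1)).aestronglyMeasurable
      (Filter.Eventually.of_forall fun x => ?_)
    rw [Real.norm_of_nonneg (hlog0 x), Real.norm_of_nonneg (Real.sqrt_nonneg _)]
    have := Real.log_le_sub_one_of_pos (x := 1 + √(f x)) (by positivity)
    linarith
  obtain ⟨hsi, hsle⟩ := integral_sqrt_le_sqrt_integral μ hlogi hlog0
  refine ⟨hsi, hsle.trans (Real.sqrt_le_sqrt ?_)⟩
  -- The logarithm lies below its tangent at `c`.
  set c : ℝ := 1 + √(∫ x, f x ∂μ) with hc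
  have hcpos : 0 < c := by positivity
  have htan : ∀ x, Real.log (1 + √(f x)) ≤ (Real.log c - 1 + c⁻¹) + c⁻¹ * √(f x) := fun x => by
    have hx : 0 < 1 + √(f x) := by positivity
    have := Real.log_le_sub_one_of_pos (x := (1 + √(f x)) / c) (by positivity)
    rw [Real.log_div hx.ne' hcpos.ne', div_eq_inv_mul] at this
    linarith
  obtain ⟨hA, hAE⟩ := integral_const_add_const_mul μ hi (Real.log c - 1 + c⁻¹) c⁻¹
  refine (integral_mono hlogi hA htan).trans ?_
  rw [hAE]
  have h1 : c⁻¹ * (1 + ∫ x, √(f x) ∂μ) ≤ 1 := by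
    rw [inv_mul_le_iff₀ hcpos]
    linarith
  linarith

end EmpiricalProcess

/-! ### Expected deviation of random Fourier features -/

section FourierFeatures

variable {d : ℕ}

/-- Chaining for random Fourier features with fixed frequencies `ω j`, the Lipschitz constant of
the process being governed by the empirical second moment of `a ω * ‖ω‖`. -/
lemma expect_iSup_rademacherSum_features_le {m : ℕ} (hd : 0 < d) (hm : 0 < m) {a : Space d → ℝ}
    {T D : ℝ} (hT : 0 < T) (hD : 0 ≤ D) (haT : ∀ ω, |a ω| ≤ T) (N : ℕ) (z : ℕ → Space d)
    (hz : ∀ n, ‖z n‖ ≤ D) (ω : Fin m → Space d) :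
    𝔼 ε : Fin m → Bool, ⨆ n, |rademacherSum (fun j => a (ω j) * h N (inner ℝ (ω j) (z n))) ε| ≤
      √m * T * √(2 * d) * (2 * (√(Real.log (1 + 2 * D / T)) +
        √(Real.log (1 + √((∑ j, a (ω j) ^ 2 * ‖ω j‖ ^ 2) / m)))) + 6) := by
  have hm0 : (0 : ℝ) < m := by exact_mod_cast hm
  set q : ℝ := (∑ j, a (ω j) ^ 2 * ‖ω j‖ ^ 2) / m with hq
  have hq0 : 0 ≤ q := by positivity
  have hmq : ∑ j, a (ω j) ^ 2 * ‖ω j‖ ^ 2 = m * q := by rw [hq]; field_simp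
  have hsm : √(m : ℝ) ^ 2 = m := Real.sq_sqrt hm0.le
  have hsm0 : 0 < √(m : ℝ) := Real.sqrt_pos.2 hm0
  have hah : ∀ x y : Space d, |a x * h N (inner ℝ x y)| ≤ T := fun x y => by
    rw [abs_mul]
    exact (mul_le_of_le_one_right (abs_nonneg _) (abs_h_le_one _ _)).trans (haT x)
  have key := expect_sup_rademacherSum_le (Z := range z)
    (fun y (j : Fin m) => a (ω j) * h N (inner ℝ (ω j) y)) (D := D) (R := √m * T)
    (L := √m * (1 + √q)) (by simpa using hd) hD (by positivity) (by positivity)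
    (by rintro _ ⟨n, rfl⟩; exact hz n) ?_ ?_
    (fun ε => ⨆ n, |rademacherSum (fun j => a (ω j) * h N (inner ℝ (ω j) (z n))) ε|)
    (fun ε b hb => ciSup_le fun n => hb (z n) ⟨n, rfl⟩)
  · rw [finrank_euclideanSpace_fin] at key
    refine key.trans ?_
    have hu : 0 ≤ 2 * D / T := by positivity
    have hsqrt : √(Real.log (1 + 2 * D * (√m * (1 + √q)) / (√m * T))) ≤
        √(Real.log (1 + 2 * D / T)) + √(Real.log (1 + √q)) := by
      have h1 : 2 * D * (√m * (1 + √q)) / (√m * T) = 2 * D / T * (1 + √q) := by field_simp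
      have h2 : 0 ≤ Real.log (1 + 2 * D / T) := Real.log_nonneg (by linarith)
      have h3 : 0 ≤ Real.log (1 + √q) := Real.log_nonneg (by linarith [Real.sqrt_nonneg q])
      have h4 : Real.log (1 + 2 * D / T * (1 + √q)) ≤
          Real.log (1 + 2 * D / T) + Real.log (1 + √q) := by
        rw [← Real.log_mul (by positivity) (by positivity)]
        refine Real.log_le_log (by positivity) ?_
        nlinarith [Real.sqrt_nonneg q]
      rw [h1]
      refine (Real.sqrt_le_sqrt h4).trans (Real.sqrt_le_iff.2 ⟨by positivity, ?_⟩)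
      nlinarith [Real.sq_sqrt h2, Real.sq_sqrt h3, mul_nonneg
        (Real.sqrt_nonneg (Real.log (1 + 2 * D / T))) (Real.sqrt_nonneg (Real.log (1 + √q)))]
    gcongr
  · rintro y -
    rw [mul_pow, hsm]
    have hsq : ∀ j, (a (ω j) * h N (inner ℝ (ω j) y)) ^ 2 ≤ T ^ 2 := fun j =>
      sq_le_sq' (abs_le.1 (hah (ω j) y)).1 (abs_le.1 (hah (ω j) y)).2
    calc ∑ j, (a (ω j) * h N (inner ℝ (ω j) y)) ^ 2 ≤ ∑ _j : Fin m, T ^ 2 :=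
          Finset.sum_le_sum fun j _ => hsq j
      _ = m * T ^ 2 := by simp
  · rintro y - y' -
    calc ∑ j, (a (ω j) * h N (inner ℝ (ω j) y) - a (ω j) * h N (inner ℝ (ω j) y')) ^ 2
        ≤ ∑ j, a (ω j) ^ 2 * ‖ω j‖ ^ 2 * ‖y - y'‖ ^ 2 := by
          refine Finset.sum_le_sum fun j _ => ?_
          rw [← mul_sub, mul_pow, mul_assoc, ← mul_pow ‖ω j‖]
          refine mul_le_mul_of_nonneg_left ?_ (sq_nonneg _)
          have h1 := abs_h_sub_h_le N (inner ℝ (ω j) y) (inner ℝ (ω j) y')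
          rw [← inner_sub_right] at h1
          rw [← sq_abs]
          exact pow_le_pow_left₀ (abs_nonneg _) (h1.trans (abs_real_inner_le_norm _ _)) 2
      _ = m * q * ‖y - y'‖ ^ 2 := by rw [← Finset.sum_mul, hmq]
      _ ≤ (√m * (1 + √q) * ‖y - y'‖) ^ 2 := by
          rw [mul_pow, mul_pow, hsm]
          gcongr
          nlinarith [Real.sq_sqrt hq0, Real.sqrt_nonneg q]

/-- The expected uniform deviation of random Fourier features with amplitude `a` bounded by `T`,
by symmetrization, chaining conditionally on the frequencies, and Jensen's inequality. -/
theorem integral_iSup_abs_features_le (Λ : Measure (Space d)) [IsProbabilityMeasure Λ] {m : ℕ}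
    (hd : 0 < d) (hm : 0 < m) {a : Space d → ℝ} {T D : ℝ} (hT : 0 < T) (hD : 0 ≤ D)
    (ham : Measurable a) (haT : ∀ ω, |a ω| ≤ T)
    (haC : Integrable (fun ω => a ω ^ 2 * ‖ω‖ ^ 2) Λ) (N : ℕ) (z : ℕ → Space d)
    (hz : ∀ n, ‖z n‖ ≤ D) :
    ∫ ω : Fin m → Space d, ⨆ n, |∑ j, (a (ω j) * h N (inner ℝ (ω j) (z n)) -
        ∫ x, a x * h N (inner ℝ x (z n)) ∂Λ)| ∂(Measure.pi fun _ => Λ) ≤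
      2 * (√m * T * √(2 * d) * (2 * (√(Real.log (1 + 2 * D / T)) +
        √(Real.log (1 + √(∫ ω, a ω ^ 2 * ‖ω‖ ^ 2 ∂Λ)))) + 6)) := by
  have hm0 : (0 : ℝ) < m := by exact_mod_cast hm
  set ν : Measure (Fin m → Space d) := Measure.pi fun _ => Λ with hν
  have hgm : ∀ n, Measurable fun x : Space d => a x * h N (inner ℝ x (z n)) := fun n =>
    ham.mul ((continuous_h N).measurable.comp (by fun_prop))
  have hgT : ∀ n (x : Space d), |a x * h N (inner ℝ x (z n))| ≤ T := fun n x => by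
    rw [abs_mul]
    exact (mul_le_of_le_one_right (abs_nonneg _) (abs_h_le_one _ _)).trans (haT x)
  set Rad : (Fin m → Bool) → (Fin m → Space d) → ℝ := fun ε ω =>
    ⨆ n, |rademacherSum (fun j => a (ω j) * h N (inner ℝ (ω j) (z n))) ε| with hRad
  have hRint : ∀ ε, Integrable (Rad ε) ν := fun ε =>
    integrable_iSup_abs (b := Fintype.card (Fin m) * T)
      (fun n => measurable_rademacherSum (fun j => (hgm n).comp (measurable_pi_apply j)) ε)
      fun n ω => abs_rademacherSum_le_card_mul (fun j => hgT n (ω j)) ε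
  have hsymm := fun ε => integral_iSup_abs_sum_sub_integral_le (ι := Fin m) Λ hgm hgT ε
  have hE := Finset.expect_le_expect (s := Finset.univ) fun ε (_ : ε ∈ Finset.univ) => hsymm ε
  rw [Fintype.expect_const, ← Finset.mul_expect] at hE
  refine hE.trans (mul_le_mul_of_nonneg_left ?_ zero_le_two)
  have hswap : 𝔼 ε, ∫ ω, Rad ε ω ∂ν = ∫ ω, 𝔼 ε, Rad ε ω ∂ν := by
    simp only [Fintype.expect_eq_sum_div_card]
    rw [integral_div, integral_finsetSum _ fun ε _ => hRint ε]
  have hRE : Integrable (fun ω => 𝔼 ε, Rad ε ω) ν := by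
    simp only [Fintype.expect_eq_sum_div_card]
    exact (integrable_finsetSum _ fun ε _ => hRint ε).div_const _
  -- The empirical second moment has the mean of a single observation.
  set f : (Fin m → Space d) → ℝ := fun ω => (∑ j, a (ω j) ^ 2 * ‖ω j‖ ^ 2) / m with hf
  have hev : ∀ j : Fin m, Integrable (fun ω : Fin m → Space d => a (ω j) ^ 2 * ‖ω j‖ ^ 2) ν ∧
      ∫ ω : Fin m → Space d, a (ω j) ^ 2 * ‖ω j‖ ^ 2 ∂ν = ∫ x, a x ^ 2 * ‖x‖ ^ 2 ∂Λ := fun j => by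
    have hev := measurePreserving_eval (fun _ : Fin m => Λ) j
    refine ⟨hev.integrable_comp_of_integrable haC, ?_⟩
    conv_rhs => rw [← hev.map_eq]
    rw [integral_map hev.measurable.aemeasurable]
    rw [hev.map_eq]
    exact haC.aestronglyMeasurable
  have hfint : Integrable f ν := (integrable_finsetSum _ fun j _ => (hev j).1).div_const _
  have hfE : ∫ ω, f ω ∂ν = ∫ x, a x ^ 2 * ‖x‖ ^ 2 ∂Λ := by
    rw [hf, integral_div, integral_finsetSum _ fun j _ => (hev j).1,
      Finset.sum_congr rfl fun j _ => (hev j).2]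
    simp only [Finset.sum_const, Finset.card_univ, Fintype.card_fin, nsmul_eq_mul]
    field_simp
  obtain ⟨hi, hle⟩ := integral_sqrt_log_one_add_sqrt_le ν hfint fun ω => by positivity
  rw [hfE] at hle
  rw [hswap]
  set κ : ℝ := √m * T * √(2 * d) with hκ
  have haff : ∀ t : ℝ, κ * (2 * (√(Real.log (1 + 2 * D / T)) + t) + 6) =
      κ * (2 * √(Real.log (1 + 2 * D / T)) + 6) + 2 * κ * t := fun t => by ring
  obtain ⟨hA, hAE⟩ := integral_const_add_const_mul ν hi
    (κ * (2 * √(Real.log (1 + 2 * D / T)) + 6)) (2 * κ)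
  refine (integral_mono hRE hA fun ω =>
    (expect_iSup_rademacherSum_features_le hd hm hT hD haT N z hz ω).trans_eq (haff _)).trans ?_
  rw [hAE, haff]
  gcongr

end FourierFeatures

/-! ### Uniform deviation on compact sets -/

section UniformDeviation

variable {d : ℕ}

lemma abs_monomial_two_smul (p q : Fin d → ℕ) (ω : Space d) :
    |monomial (2 • p + 2 • q) ω| = amplitude p q ω ^ 2 := by
  rw [← sq_abs (amplitude p q ω), abs_amplitude, ← smul_add, two_smul, monomial_add, abs_mul, sq]

/-- The amplitude is bounded on the support of `Λ` by `√T_{2p,2q}`, which is at most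
`T_{p,q}`. -/
lemma abs_amplitude_le_sqrt_T {Λ : Measure (Space d)} {p q : Fin d → ℕ}
    (hT : BddAbove ((fun ω => |monomial (p + q) ω|) '' Λ.support)) :
    (∀ ω ∈ Λ.support, |amplitude p q ω| ≤ √(T Λ (2 • p) (2 • q))) ∧
      √(T Λ (2 • p) (2 • q)) ≤ T Λ p q := by
  have hle : ∀ ω ∈ Λ.support, |monomial (p + q) ω| ≤ T Λ p q := fun ω hω =>
    le_csSup hT ⟨ω, hω, rfl⟩
  have hT0 : 0 ≤ T Λ p q := Real.sSup_nonneg (by rintro _ ⟨ω, -, rfl⟩; exact abs_nonneg _)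
  have hsq : ∀ ω ∈ Λ.support, |monomial (2 • p + 2 • q) ω| ≤ T Λ p q ^ 2 := fun ω hω => by
    rw [abs_monomial_two_smul, ← sq_abs, abs_amplitude]
    exact pow_le_pow_left₀ (abs_nonneg _) (hle ω hω) 2
  refine ⟨fun ω hω => Real.abs_le_sqrt ?_, Real.sqrt_le_iff.2 ⟨hT0, ?_⟩⟩
  · rw [← abs_monomial_two_smul]
    exact le_csSup ⟨_, by rintro _ ⟨ω, hω, rfl⟩; exact hsq ω hω⟩ ⟨ω, hω, rfl⟩
  · exact Real.sSup_le (by rintro _ ⟨ω, hω, rfl⟩; exact hsq ω hω) (sq_nonneg _)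

lemma U_pos {Λ : Measure (Space d)} {p q : Fin d → ℕ} (hT : 0 < T Λ (2 • p) (2 • q))
    {S : Set (Space d)} (hS : IsCompact S) (hS' : S.Nontrivial) : 0 < U Λ p q S := by
  have h1 : 0 < Metric.diam S := Metric.diam_pos hS' hS.isBounded
  have h2 : 0 < 2 * Metric.diam S / √(T Λ (2 • p) (2 • q)) := by positivity
  exact Real.log_pos (by linarith)

/-- The numerical comparison of the chaining bound with `H`; the term `1 / (2 √U)` absorbs the
additive constant because `√U + 1 / (2 √U) ≥ 1`. -/
lemma chaining_bound_le_H (Λ : Measure (Space d)) (p q : Fin d → ℕ) (S : Set (Space d))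
    (hU : 0 < U Λ p q S) :
    2 * (√(T Λ (2 • p) (2 • q)) * √(2 * d) * (2 * (√(U Λ p q S) +
      √(Real.log (1 + √(C Λ (2 • p) (2 • q))))) + 6)) ≤ H Λ p q S := by
  have hu : 0 < √(U Λ p q S) := Real.sqrt_pos.2 hU
  rw [H, Real.sqrt_mul (x := 2 * (d : ℝ)) (by positivity), add_comm (√(C Λ (2 • p) (2 • q))) 1]
  set u := √(U Λ p q S)
  set l := √(Real.log (1 + √(C Λ (2 • p) (2 • q))))
  have hl : 0 ≤ l := Real.sqrt_nonneg _
  have h1 : 1 ≤ u + 1 / (2 * u) := by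
    have h2 : u + 1 / (2 * u) - 1 = ((u - 1) ^ 2 + u ^ 2) / (2 * u) := by field_simp; ring
    have h3 : 0 ≤ ((u - 1) ^ 2 + u ^ 2) / (2 * u) := by positivity
    linarith
  have h4 : 0 ≤ 1 / (2 * u) := by positivity
  have h5 : 0 ≤ √(T Λ (2 • p) (2 • q)) * √(2 * d) := by positivity
  have h6 := mul_le_mul_of_nonneg_left
    (show 4 * u + 4 * l + 12 ≤ 32 * (u + 1 / (2 * u) + l) by linarith) h5
  linarith

/-- The uniform deviation over a dense sequence of `Z` dominates the one over `Z`, by continuity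
in the argument. -/
lemma abs_le_iSup_of_denseRange {Z : Set (Space d)} {z : ℕ → Z} (hz : DenseRange z)
    {G : Space d → ℝ} (hG : Continuous G) {b : ℝ} (hb : ∀ n, |G (z n)| ≤ b) {y : Space d}
    (hy : y ∈ Z) : |G y| ≤ ⨆ n, |G (z n)| := by
  have hclosed : IsClosed {y : Z | |G y| ≤ ⨆ n, |G (z n)|} :=
    isClosed_le (by fun_prop) continuous_const
  have hsub : range z ⊆ {y : Z | |G y| ≤ ⨆ n, |G (z n)|} := by
    rintro _ ⟨n, rfl⟩
    exact le_ciSup (bddAbove_range_abs hb) n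
  exact closure_minimal hsub hclosed (hz ⟨y, hy⟩)

/-- The amplitude truncated at level `t`. It agrees almost surely with the amplitude if the latter
is bounded by `t` on the support, and is bounded everywhere. -/
noncomputable def clampedAmplitude (p q : Fin d → ℕ) (t : ℝ) (ω : Space d) : ℝ :=
  max (-t) (min t (amplitude p q ω))

lemma abs_clampedAmplitude_le (p q : Fin d → ℕ) {t : ℝ} (ht : 0 ≤ t) (ω : Space d) :
    |clampedAmplitude p q t ω| ≤ t :=
  abs_le.2 ⟨le_max_left _ _, max_le (by linarith) (min_le_left _ _)⟩

lemma clampedAmplitude_eq {p q : Fin d → ℕ} {t : ℝ} {ω : Space d}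
    (h : |amplitude p q ω| ≤ t) : clampedAmplitude p q t ω = amplitude p q ω := by
  rw [clampedAmplitude, min_eq_right (abs_le.1 h).2, max_eq_right (abs_le.1 h).1]

lemma continuous_clampedAmplitude (p q : Fin d → ℕ) (t : ℝ) :
    Continuous (clampedAmplitude p q t) :=
  continuous_const.max (continuous_const.min (continuous_amplitude p q))

/-- The uniform deviation bound with the derivative of the kernel in integral form. Both sides
depend on `x` and `y` only through `x - y`, which ranges over a subset of the ball of radius
`|S|`. -/
theorem measure_supNormOn_kernelDeriv_sub_rffEstimate_le (Λ : Measure (Space d))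
    [IsProbabilityMeasure Λ] (p q : Fin d → ℕ)
    (hT : BddAbove ((fun ω => |monomial (p + q) ω|) '' Λ.support))
    (hT_pos : 0 < T Λ (2 • p) (2 • q))
    (hC : Integrable (fun ω => |monomial (2 • p + 2 • q) ω| * ‖ω‖ ^ 2) Λ)
    (S : Set (Space d)) (hS : IsCompact S) (hS' : S.Nontrivial)
    (m : ℕ) (hm : 0 < m) (τ : ℝ) (hτ : 0 < τ) :
    Measure.pi (fun _ : Fin m => Λ)
        {ω | ENNReal.ofReal (H Λ p q S / √m + T Λ p q * √(2 * τ / m))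
          ≤ supNormOn S (fun x y => kernelDeriv Λ p q x y - rffEstimate p q ω x y)}
      ≤ ENNReal.ofReal (Real.exp (-τ)) := by
  have hm0 : (0 : ℝ) < m := by exact_mod_cast hm
  have hd : 0 < d := by
    rcases Nat.eq_zero_or_pos d with rfl | hd
    · obtain ⟨x, -, y, -, hxy⟩ := hS'
      exact absurd (Subsingleton.elim x y) hxy
    · exact hd
  obtain ⟨hamp, htT⟩ := abs_amplitude_le_sqrt_T hT
  set t : ℝ := √(T Λ (2 • p) (2 • q)) with ht
  have ht0 : 0 < t := Real.sqrt_pos.2 hT_pos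
  set N := order (p + q) with hN
  set a := clampedAmplitude p q t with ha
  have haT : ∀ ω, |a ω| ≤ t := abs_clampedAmplitude_le p q ht0.le
  have haeq : ∀ᵐ ω ∂Λ, a ω = amplitude p q ω := by
    filter_upwards [Measure.support_mem_ae] with ω hω using clampedAmplitude_eq (hamp ω hω)
  have haC : (fun ω => a ω ^ 2 * ‖ω‖ ^ 2) =ᵐ[Λ]
      fun ω => |monomial (2 • p + 2 • q) ω| * ‖ω‖ ^ 2 := by
    filter_upwards [haeq] with ω hω
    rw [hω, abs_monomial_two_smul]
  -- A dense sequence of the compact set of differences `x - y`, `x, y ∈ S`.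
  set Z : Set (Space d) := (fun w : Space d × Space d => w.1 - w.2) '' (S ×ˢ S) with hZ
  have hZD : ∀ y ∈ Z, ‖y‖ ≤ Metric.diam S := by
    rintro _ ⟨⟨x, y⟩, ⟨hx, hy⟩, rfl⟩
    rw [← dist_eq_norm]
    exact Metric.dist_le_diam_of_mem hS.isBounded hx hy
  have hZne : Nonempty Z := by
    obtain ⟨x, hx⟩ := hS'.nonempty
    exact ⟨⟨x - x, ⟨(x, x), ⟨hx, hx⟩, rfl⟩⟩⟩
  obtain ⟨z, hz⟩ := TopologicalSpace.exists_dense_seq Z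
  set g : ℕ → Space d → ℝ := fun n x => a x * h N (inner ℝ x (z n)) with hg
  have hgm : ∀ n, Measurable (g n) := fun n =>
    (continuous_clampedAmplitude p q t).measurable.mul
      ((continuous_h N).measurable.comp (by fun_prop))
  have hgT : ∀ n x, |g n x| ≤ t := fun n x => by
    rw [hg, abs_mul]
    exact (mul_le_of_le_one_right (abs_nonneg _) (abs_h_le_one _ _)).trans (haT x)
  have hE : ∫ ω : Fin m → Space d, ⨆ n, |∑ j, (g n (ω j) - ∫ x, g n x ∂Λ)|
      ∂(Measure.pi fun _ => Λ) ≤ m * (H Λ p q S / √m) := by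
    refine (integral_iSup_abs_features_le Λ hd hm ht0 Metric.diam_nonneg
      (continuous_clampedAmplitude p q t).measurable haT (hC.congr haC.symm) N (fun n => z n)
      fun n => hZD _ (z n).2).trans ?_
    rw [integral_congr_ae haC, add_comm 1 (2 * Metric.diam S / t)]
    have h1 := mul_le_mul_of_nonneg_left
      (chaining_bound_le_H Λ p q S (U_pos hT_pos hS hS')) (Real.sqrt_nonneg (m : ℝ))
    have h2 : (m : ℝ) * (H Λ p q S / √m) = √m * H Λ p q S := by
      rw [mul_div_left_comm, Real.div_sqrt, mul_comm]
    rw [h2]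
    refine le_trans (le_of_eq ?_) h1
    rw [U, C]
    ring
  refine (measure_mono_ae ?_).trans
    (measure_add_le_iSup_abs_sum_sub_integral_le Λ hm ht0 hτ hgm hgT hE)
  have hsupp : ∀ᵐ ω ∂(Measure.pi fun _ : Fin m => Λ), ∀ j, a (ω j) = amplitude p q (ω j) :=
    ae_all_iff.2 fun j => (measurePreserving_eval (fun _ : Fin m => Λ) j).quasiMeasurePreserving.ae
      haeq
  filter_upwards [hsupp] with ω hω hmem
  replace hmem : ENNReal.ofReal (H Λ p q S / √m + T Λ p q * √(2 * τ / m)) ≤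
      supNormOn S (fun x y => kernelDeriv Λ p q x y - rffEstimate p q ω x y) := hmem
  -- The deviation of the estimate as a function of the difference of the two arguments.
  set G : Space d → ℝ := fun y =>
    ∑ j, (a (ω j) * h N (inner ℝ (ω j) y) - ∫ x, a x * h N (inner ℝ x y) ∂Λ) with hG
  have hai : Integrable a Λ :=
    Integrable.of_bound (continuous_clampedAmplitude p q t).aestronglyMeasurable t
      (Filter.Eventually.of_forall haT)
  have hGc : Continuous G := by
    refine continuous_finsetSum _ fun j _ => Continuous.sub ?_ ?_
    · exact continuous_const.mul ((continuous_h N).comp (by fun_prop))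
    · refine continuous_of_dominated (bound := fun x => |a x|)
        (fun y => (integrable_mul_h hai N y).aestronglyMeasurable)
        (fun y => Filter.Eventually.of_forall fun x => ?_) hai.abs
        (Filter.Eventually.of_forall fun x =>
          continuous_const.mul ((continuous_h N).comp (by fun_prop)))
      rw [norm_mul]
      exact mul_le_of_le_one_right (norm_nonneg _) (abs_h_le_one _ _)
  have hGb : ∀ n, |G (z n)| ≤ m * (t + t) := fun n => by
    have hmean : |∫ x, g n x ∂Λ| ≤ t := by
      have := norm_integral_le_of_norm_le_const (μ := Λ) (f := g n)
        (Filter.Eventually.of_forall (hgT n))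
      simpa using this
    refine (Finset.abs_sum_le_sum_abs _ _).trans ((Finset.sum_le_sum fun j _ =>
      (abs_sub _ _).trans (add_le_add (hgT n (ω j)) hmean)).trans_eq ?_)
    rw [Finset.sum_const, Finset.card_univ, Fintype.card_fin, nsmul_eq_mul]
  have hdev : ∀ x y, kernelDeriv Λ p q x y - rffEstimate p q ω x y =
      -((1 / (m : ℝ)) * G (x - y)) := by
    intro x y
    have h1 : kernelDeriv Λ p q x y = ∫ v, a v * h N (inner ℝ v (x - y)) ∂Λ := by
      refine integral_congr_ae ?_
      filter_upwards [haeq] with v hv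
      rw [hv]
    have h2 : ∑ j, monomial p (ω j) * monomial q (-(ω j)) * h (order (p + q))
        (inner ℝ (ω j) (x - y)) = ∑ j, a (ω j) * h N (inner ℝ (ω j) (x - y)) :=
      Finset.sum_congr rfl fun j _ => by rw [hω j, amplitude]
    rw [h1, rffEstimate, h2]
    simp only [hG]
    rw [Finset.sum_sub_distrib, Finset.sum_const, Finset.card_univ,
      Fintype.card_fin, nsmul_eq_mul]
    field_simp
    ring
  have hsup : supNormOn S (fun x y => kernelDeriv Λ p q x y - rffEstimate p q ω x y) ≤
      ENNReal.ofReal ((1 / (m : ℝ)) * ⨆ n, |G (z n)|) := by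
    refine iSup₂_le fun x hx => iSup₂_le fun y hy => ENNReal.ofReal_le_ofReal ?_
    simp only [hdev]
    rw [abs_neg, abs_mul, abs_of_nonneg (by positivity)]
    exact mul_le_mul_of_nonneg_left
      (abs_le_iSup_of_denseRange hz hGc hGb ⟨(x, y), ⟨hx, hy⟩, rfl⟩) (by positivity)
  have hnonneg : 0 ≤ (1 / (m : ℝ)) * ⨆ n, |G (z n)| :=
    mul_nonneg (by positivity) (iSup_abs_nonneg _)
  have hfin := (ENNReal.ofReal_le_ofReal_iff hnonneg).1 (hmem.trans hsup)
  refine le_trans ?_ hfin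
  gcongr

end UniformDeviation

end RandomFourier

/-! ### Uniform approximation of kernel derivatives -/

theorem mainTheorem1 {d : ℕ} (k : RandomFourier.Space d → RandomFourier.Space d → ℝ)
    (Λ : Measure (RandomFourier.Space d)) [IsProbabilityMeasure Λ]
    (hk : RandomFourier.IsSpectralMeasure k Λ)
    (p q : Fin d → ℕ)
    (hmoment : ∀ r : Fin d → ℕ, r ≤ p + q → Integrable (RandomFourier.monomial r) Λ)
    (hT : BddAbove ((fun ω => |RandomFourier.monomial (p + q) ω|) '' Λ.support))
    (hT_pos : 0 < RandomFourier.T Λ (2 • p) (2 • q))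
    (hC : Integrable (fun ω => |RandomFourier.monomial (2 • p + 2 • q) ω| * ‖ω‖ ^ 2) Λ)
    (S : Set (RandomFourier.Space d)) (hS : IsCompact S) (hS' : S.Nontrivial)
    (m : ℕ) (hm : 0 < m) (τ : ℝ) (hτ : 0 < τ) :
    (∃! D, RandomFourier.HasMixedPartial k p q D) ∧
    ∀ D, RandomFourier.HasMixedPartial k p q D →
      Measure.pi (fun _ : Fin m => Λ)
          {ω | ENNReal.ofReal (RandomFourier.H Λ p q S / √m
                + RandomFourier.T Λ p q * √(2 * τ / m))
              ≤ RandomFourier.supNormOn S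
                  (fun x y => D x y - RandomFourier.rffEstimate p q ω x y)}
        ≤ ENNReal.ofReal (Real.exp (-τ)) := by
  refine ⟨⟨RandomFourier.kernelDeriv Λ p q,
    RandomFourier.hasMixedPartial_kernelDeriv hk _ p q rfl hmoment,
    fun D hD => hD.eq_kernelDeriv hk hmoment⟩, fun D hD => ?_⟩
  rw [hD.eq_kernelDeriv hk hmoment]
  exact RandomFourier.measure_supNormOn_kernelDeriv_sub_rffEstimate_le Λ p q hT hT_pos hC S hS hS'
    m hm τ hτ
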